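/- Let $n\ge 0$, and for a point $p=(x,y,z)$ of the closed unit ball of $\mathbb R^3$, with $r=\|p\|=\sqrt{x^2+y^2+z^2}$, let $$\rho=\frac12\begin{pmatrix}1+z&x-iy\\x+iy&1-z\end{pmatrix},$$ and let $\rho^{\otimes n}$ be its $n$-fold tensor power, a $2^n\times2^n$ matrix whose rows and columns are indexed by the subsets of $[n]=\{1,\dots,n\}$ (the $k$-th tensor index is the first basis vector if $k$ belongs to the subset, and the second one otherwise). Let $w$ be a spherically symmetric probability density on the unit ball, i.e. $w(x,y,z)=w(r)$ depends only on $r$, and let $$\hat\zeta_n(w)=\int_{x^2+y^2+z^2\le1}\rho^{\otimes n}\,w\,dx\,dy\,dz .$$ Then the Hermitian matrix $\hat\zeta_n(w)$ is positive definite, and its eigenvalues are exactly the numbers $$\lambda_d=\frac{\pi}{2^{n-1}(n-2d+1)}\int_{-1}^{1}r(1+r)^{n-d+1}(1-r)^d\,w(|r|)\,dr,\qquad d=0,1,\dots,\lfloor n/2\rfloor,$$ where the integral is understood as a principal value at $r=0$ (the limit for $\varepsilon\downarrow0$ of the integral over $\varepsilon\le|r|\le1$, which always exists) if it does not converge absolutely.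 The eigenvalue $\lambda_d$ has multiplicity $$\frac{(n-2d+1)^2}{n+1}\binom{n+1}{d},$$ and its eigenspace has as a basis the vectors $v_{d,s}(P)$, where $d\le s\le n-d$ and $P$ is a ballot path from $(0,0)$ to $(n,n-2d)$, i.e. a lattice path with $n-d$ up-steps $(1,1)$ and $d$ down-steps $(1,-1)$ that never goes below the horizontal axis. Here, if $A$ denotes the set of the positions (in $[n]$) of the first $d$ up-steps of $P$, and $B$ the set of the positions of the $d$ down-steps of $P$, $$v_{d,s}(P)=\sum_{X\subseteq A}\ \sum_{\substack{Y\subseteq[n]\setminus(A\cup B)\\|Y|=s-d}}(-1)^{|X|}\,e_{X\cup X'\cup Y},$$ where $e_T$ are the standard unit vectors, and where, if $X$ consists of the $i_1$-, $i_2$-, ... largest elements of $A$, $X'$ consists of all elements of $B$ except the $i_1$-, $i_2$-, ... largest ones. Moreover, for each $p$ in the unit ball, the relative entropy $\operatorname{Tr}\,\rho^{\otimes n}\bigl(\log\rho^{\otimes n}-\log\hat\zeta_n(w)\bigr)$ of $\rho^{\otimes n}$ with respect to $\hat\zeta_n(w)$ (with the convention $0\log0=0$) equals $$\frac n2(1-r)\log\frac{1-r}2+\frac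 n2(1+r)\log\frac{1+r}2-\sum_{d=0}^{\lfloor n/2\rfloor}\frac{n-2d+1}{n+1}\binom{n+1}d\frac{1}{2^{n+1}r}\Bigl((1+r)^{n-d+1}(1-r)^d-(1+r)^d(1-r)^{n-d+1}\Bigr)\log\lambda_d$$ if $0<r\le1$, and the limit of this expression for $r\downarrow0$ if $r=0$, namely $$-n\log2-\frac1{2^n}\sum_{d=0}^{\lfloor n/2\rfloor}\frac{(n-2d+1)^2}{n+1}\binom{n+1}d\log\lambda_d .$$ -/

import Mathlib

open MeasureTheory Filter Topology
open scoped ComplexOrder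

noncomputable section

/-- The qubit density matrix `(1/2) [[1 + z, x - i y], [x + i y, 1 - z]]` of the point
`p = (x, y, z)` of the unit ball. -/
def qubit (p : EuclideanSpace ℝ (Fin 3)) : Matrix (Fin 2) (Fin 2) ℂ :=
  (1 / 2 : ℂ) •
    !![1 + (p 2 : ℂ), (p 0 : ℂ) - Complex.I * (p 1 : ℂ);
       (p 0 : ℂ) + Complex.I * (p 1 : ℂ), 1 - (p 2 : ℂ)]

/-- The `n`-fold tensor (Kronecker) power of a `2 × 2` matrix. Rows and columns are indexed by
subsets of the `n`-element set of tensor factors: the `k`-th tensor index is the first basis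
vector if `k` belongs to the subset, and the second one otherwise. -/
def tensorPower (n : ℕ) (M : Matrix (Fin 2) (Fin 2) ℂ) :
    Matrix (Finset (Fin n)) (Finset (Fin n)) ℂ :=
  Matrix.of fun I J => ∏ k : Fin n, M (if k ∈ I then 0 else 1) (if k ∈ J then 0 else 1)

/-- The average over the unit ball, against the density `w`, of the `n`-fold tensor power of the
qubit density matrix (the integral is taken entrywise). -/
def averageState (n : ℕ) (w : EuclideanSpace ℝ (Fin 3) → ℝ) :
    Matrix (Finset (Fin n)) (Finset (Fin n)) ℂ :=
  Matrix.of fun I J =>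
    ∫ p in Metric.closedBall (0 : EuclideanSpace ℝ (Fin 3)) 1,
      tensorPower n (qubit p) I J * (w p : ℂ)

/-- The quantum relative entropy `Tr A (log A - log B)`; the logarithm is given by the functional
calculus for Hermitian matrices, with the convention `0 log 0 = 0`. -/
def quantumRelativeEntropy {ι : Type*} [Fintype ι] [DecidableEq ι] (A B : Matrix ι ι ℂ) : ℂ :=
  (A * (cfc Real.log A - cfc Real.log B)).trace

/-- The height, after `k` steps, of the lattice path from `(0,0)` whose `i`-th step is
`(1,1)` if `p i = true` and `(1,-1)` if `p i = false`. -/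
def pathHeight {n : ℕ} (p : Fin n → Bool) (k : ℕ) : ℤ :=
  ∑ i : Fin n with i.val < k, if p i = true then 1 else -1

/-- Ballot paths from `(0,0)` to `(n, n - 2d)`: they never go below the horizontal axis. -/
structure BallotPath (n d : ℕ) where
  /-- the steps of the path, `true` for an up-step and `false` for a down-step -/
  step : Fin n → Bool
  nonneg : ∀ k : ℕ, k ≤ n → 0 ≤ pathHeight step k
  endpoint : pathHeight step n = (n : ℤ) - 2 * (d : ℤ)

/-- The positions of the first `d` up-steps. -/
def BallotPath.upSet {n d : ℕ} (P : BallotPath n d) : Finset (Fin n) :=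
  {i | P.step i = true ∧ ({j | j < i ∧ P.step j = true} : Finset (Fin n)).card < d}

/-- The positions of the down-steps. -/
def BallotPath.downSet {n d : ℕ} (P : BallotPath n d) : Finset (Fin n) :=
  {i | P.step i = false}

/-- The rank of `a` in `A`, counted from the largest element (which has rank `0`). -/
def rankIn {n : ℕ} (A : Finset (Fin n)) (a : Fin n) : ℕ :=
  ({x ∈ A | a < x} : Finset (Fin n)).card

/-- The complement of `X ⊆ A` in `B`: all elements of `B` except those whose rank in `B` is the
rank in `A` of an element of `X`. -/
def matchedCompl {n : ℕ} (A B X : Finset (Fin n)) : Finset (Fin n) :=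
  {b ∈ B | ∀ a ∈ X, rankIn A a ≠ rankIn B b}

/-- The vector `v_{d,s}(A,B) = ∑ (-1)^|X| e_{X ∪ X' ∪ Y}`, summed over `X ⊆ A` and over the
`(s-d)`-element subsets `Y` of the complement of `A ∪ B`. -/
def vVec {n : ℕ} (d s : ℕ) (A B : Finset (Fin n)) : Finset (Fin n) → ℂ :=
  ∑ X ∈ A.powerset, ∑ Y ∈ ((A ∪ B)ᶜ).powersetCard (s - d),
    (-1 : ℂ) ^ X.card • Pi.single (X ∪ matchedCompl A B X ∪ Y) (1 : ℂ)

/-- For fixed `d`, the family of the vectors `v_{d,s}(P) = v_{d,s}(A_P, B_P)`, where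
`d ≤ s ≤ n - d` and `P` is a ballot path from `(0,0)` to `(n, n - 2d)`. -/
def ballotVec (n d : ℕ) (q : ↥(Finset.Icc d (n - d)) × BallotPath n d) : Finset (Fin n) → ℂ :=
  vVec d (q.1 : ℕ) q.2.upSet q.2.downSet

/-- `F` is integrable on `[-1, 1]` away from `0`, and `a` is the principal value at `0` of
`∫_{-1}^1 F(r) dr`, that is, the limit for `ε ↓ 0` of the integral over `ε ≤ |r| ≤ 1`. -/
def HasPrincipalValue (F : ℝ → ℝ) (a : ℝ) : Prop :=
  (∀ ε : ℝ, 0 < ε → ε ≤ 1 →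
    IntervalIntegrable F volume (-1) (-ε) ∧ IntervalIntegrable F volume ε 1) ∧
  Tendsto (fun ε : ℝ => (∫ r in (-1 : ℝ)..(-ε), F r) + ∫ r in ε..1, F r) (𝓝[>] 0) (𝓝 a)

/-- The integrand `r (1+r)^{n-d+1} (1-r)^d g(|r|)`, where `g` is the radial profile of the
density. -/
def eigenIntegrand (n d : ℕ) (g : ℝ → ℝ) (r : ℝ) : ℝ :=
  r * (1 + r) ^ (n - d + 1) * (1 - r) ^ d * g |r|

/-- The factor `π / (2^{n-1} (n - 2d + 1))`. -/
def eigenFactor (n d : ℕ) : ℝ :=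
  Real.pi / ((2 : ℝ) ^ ((n : ℤ) - 1) * ((n : ℝ) - 2 * (d : ℝ) + 1))

end

/-!
The vectors `v_{d,s}(A,B)`, for a fixed pair of disjoint `d`-sets `A`, `B` matched by rank, form a
basis of `pairSpace A B`, the vectors that are antisymmetric under each transposition of a matched
pair and symmetric under the transpositions of the other tensor factors (`IsPairing.eq_sum`). So
every matrix that commutes with the permutations of the tensor factors, in particular every
`M^{⊗n}` and the averaged state `ζ`, maps this space to itself.

Conjugation of `ρ` by a unitary matrix `U` rotates the Bloch vector, so `ζ` commutes with all
`U^{⊗n}`. The rotations about the `z`-axis show that `ζ` does not mix subsets of different sizes;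
hence each `v_{d,s}(A,B)` is an eigenvector. The Hadamard rotation maps `v_{d,n-d}(A,B)` to a
combination of all the `v_{d,s}(A,B)` with nonzero coefficients, so the eigenvalues for the
different `s` agree (`IsPairing.averageState_mulVec`). Their sum is the trace of `ζ` on the space,
which is the average of the trace of `ρ^{⊗n}`, and that trace only depends on the eigenvalues
`(1 ± r) / 2` of `ρ`: it is `eigenWeight n d r`, the sum of `λ₊^s λ₋^(n-s)` over `d ≤ s ≤ n - d`.
Summing the geometric series and passing to polar coordinates turns the average into the principal
value. The end terms of the sum exceed the other ones, which makes the eigenvalues strictly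
decreasing in `d` (`ballEigenvalue_succ_lt`).

For `s = d` the vectors of the ballot paths are triangular with respect to the sum of the positions
of the down-steps, because each up-step precedes the down-step it is matched with; a lowering
operator reduces `s > d` to this case (`linearIndependent_ballotVec`). The recursion for ballot
paths shows that there are `2^n` vectors in total, so they form a basis, and the eigenspaces are
exactly the spans. In this basis the trace of `ρ^{⊗n} log ζ` can be read off once `ρ` has been
rotated to a diagonal matrix, which does not affect `ζ` (`quantumRelativeEntropy_eq`).
-/

/-! ### Ranks and matched pairs -/

lemma rankIn_lt_card {n : ℕ} {A : Finset (Fin n)} {a : Fin n} (ha : a ∈ A) :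
    rankIn A a < A.card := by
  refine Finset.card_lt_card ⟨Finset.filter_subset _ _, fun h => ?_⟩
  simpa using h ha

lemma rankIn_lt_rankIn {n : ℕ} {A : Finset (Fin n)} {a b : Fin n} (hb : b ∈ A) (hab : a < b) :
    rankIn A b < rankIn A a := by
  refine Finset.card_lt_card ⟨fun x hx => ?_, fun h => ?_⟩
  · simp only [Finset.mem_filter] at hx ⊢
    exact ⟨hx.1, hab.trans hx.2⟩
  · have := h (Finset.mem_filter.2 ⟨hb, hab⟩)
    simp at this

lemma rankIn_injOn {n : ℕ} (A : Finset (Fin n)) : Set.InjOn (rankIn A) A := by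
  intro a ha b hb h
  rcases lt_trichotomy a b with hab | hab | hab
  · exact absurd h (rankIn_lt_rankIn hb hab).ne'
  · exact hab
  · exact absurd h (rankIn_lt_rankIn ha hab).ne

lemma exists_rankIn_eq {n : ℕ} {A : Finset (Fin n)} {k : ℕ} (hk : k < A.card) :
    ∃ a ∈ A, rankIn A a = k := by
  have h : A.image (rankIn A) = Finset.range A.card := by
    refine Finset.eq_of_subset_of_card_le (fun k hk => ?_) ?_
    · obtain ⟨a, ha, rfl⟩ := Finset.mem_image.1 hk
      exact Finset.mem_range.2 (rankIn_lt_card ha)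
    · rw [Finset.card_image_of_injOn (rankIn_injOn A), Finset.card_range]
  have := h ▸ Finset.mem_range.2 hk
  simpa using this

/-- A set of tensor positions that contains exactly one element of each matched pair `(a, b)`,
i.e. of each pair `a ∈ A`, `b ∈ B` of elements of the same rank. -/
def IsTransversal {n : ℕ} (A B T : Finset (Fin n)) : Prop :=
  ∀ a ∈ A, ∀ b ∈ B, rankIn A a = rankIn B b → (a ∈ T ↔ b ∉ T)

lemma isTransversal_iff {n : ℕ} {A B T : Finset (Fin n)} (hcard : A.card = B.card) :
    IsTransversal A B T ↔ T ∩ B = matchedCompl A B (T ∩ A) := by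
  constructor
  · intro h
    ext b
    simp only [Finset.mem_inter, matchedCompl, Finset.mem_filter]
    constructor
    · rintro ⟨hbT, hb⟩
      exact ⟨hb, fun a ha hr => ((h a ha.2 b hb hr).1 ha.1) hbT⟩
    · rintro ⟨hb, hX⟩
      obtain ⟨a, ha, hr⟩ := exists_rankIn_eq (A := A) (hcard ▸ rankIn_lt_card hb)
      by_contra hbT
      exact hX a ⟨(h a ha b hb hr).2 fun h' => hbT ⟨h', hb⟩, ha⟩ hr
  · intro h a ha b hb hr
    have hb' : b ∈ T ↔ ∀ x ∈ T ∩ A, rankIn A x ≠ rankIn B b := by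
      have := Finset.ext_iff.1 h b
      simpa [matchedCompl, hb] using this
    rw [hb']
    push Not
    constructor
    · intro haT
      exact ⟨a, Finset.mem_inter.2 ⟨haT, ha⟩, hr⟩
    · rintro ⟨x, hx, hxr⟩
      rw [Finset.mem_inter] at hx
      rw [rankIn_injOn A ha hx.2 (hr.trans hxr.symm)]
      exact hx.1

open Classical in
/-- The coordinates of `v_{d,s}(A,B)`. -/
lemma vVec_apply {n : ℕ} (d s : ℕ) {A B : Finset (Fin n)} (hAB : Disjoint A B)
    (hcard : A.card = B.card) (T : Finset (Fin n)) :
    vVec d s A B T =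
      if IsTransversal A B T ∧ (T \ (A ∪ B)).card = s - d then (-1) ^ (T ∩ A).card else 0 := by
  -- `T = X ∪ X' ∪ Y` determines `X`, `X'` and `Y` as the traces of `T` on `A`, `B` and the rest.
  have key : ∀ X ∈ A.powerset, ∀ Y ∈ ((A ∪ B)ᶜ).powersetCard (s - d),
      (T = X ∪ matchedCompl A B X ∪ Y ↔
        (X = T ∩ A ∧ Y = T \ (A ∪ B)) ∧ IsTransversal A B T) := by
    intro X hX Y hY
    rw [isTransversal_iff hcard]
    rw [Finset.mem_powerset] at hX
    have hY' := (Finset.mem_powersetCard.1 hY).1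
    have hM : matchedCompl A B X ⊆ B := Finset.filter_subset _ _
    have hdis : ∀ x, x ∈ A → x ∉ B := fun x h1 h2 => Finset.disjoint_left.1 hAB h1 h2
    have hYc : ∀ x, x ∈ Y → x ∉ A ∧ x ∉ B := fun x hx => by simpa using hY' hx
    constructor
    · intro h
      have h1 : X = T ∩ A := by
        ext x
        simp only [h, Finset.mem_inter, Finset.mem_union]
        have := @hX x; have := @hM x; have := hYc x; have := hdis x
        tauto
      refine ⟨⟨h1, ?_⟩, ?_⟩
      · ext x
        simp only [h, Finset.mem_sdiff, Finset.mem_union]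
        have := @hX x; have := @hM x; have := hYc x
        tauto
      · rw [← h1]
        ext x
        simp only [h, Finset.mem_inter, Finset.mem_union]
        have := @hX x; have := @hM x; have := hYc x; have := hdis x
        tauto
    · rintro ⟨⟨h1, h2⟩, h3⟩
      rw [h1, ← h3, h2]
      ext x
      simp only [Finset.mem_inter, Finset.mem_union, Finset.mem_sdiff]
      tauto
  have hval : vVec d s A B T = ∑ X ∈ A.powerset, ∑ Y ∈ ((A ∪ B)ᶜ).powersetCard (s - d),
      if T = X ∪ matchedCompl A B X ∪ Y then (-1 : ℂ) ^ X.card else 0 := by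
    simp [vVec, Finset.sum_apply, Pi.single_apply]
  rw [hval]
  by_cases hT : IsTransversal A B T
  · have : ∀ X ∈ A.powerset, (∑ Y ∈ ((A ∪ B)ᶜ).powersetCard (s - d),
        if T = X ∪ matchedCompl A B X ∪ Y then (-1 : ℂ) ^ X.card else 0) =
        if X = T ∩ A then (if (T \ (A ∪ B)).card = s - d then (-1) ^ X.card else 0) else 0 := by
      intro X hX
      rw [Finset.sum_congr rfl fun Y hY => by rw [if_congr (key X hX Y hY) rfl rfl]]
      by_cases hXT : X = T ∩ A
      · simp only [hXT, hT, true_and, and_true, if_true]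
        rw [Finset.sum_ite_eq']
        have : (T \ (A ∪ B) ∈ ((A ∪ B)ᶜ).powersetCard (s - d)) ↔
            (T \ (A ∪ B)).card = s - d := by
          rw [Finset.mem_powersetCard, and_iff_right]
          intro x; simp +contextual
        simp only [this]
      · simp [hXT]
    rw [Finset.sum_congr rfl this, Finset.sum_ite_eq', if_pos (by simp)]
    simp [hT]
  · simp only [hT, false_and, if_false]
    refine Finset.sum_eq_zero fun X hX => Finset.sum_eq_zero fun Y hY => if_neg fun h => ?_
    exact hT ((key X hX Y hY).1 h).2

lemma card_of_vVec_ne_zero {n d s : ℕ} {A B T : Finset (Fin n)} (hAB : Disjoint A B)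
    (hA : A.card = d) (hB : B.card = d) (hs : d ≤ s) (h : vVec d s A B T ≠ 0) : T.card = s := by
  classical
  rw [vVec_apply d s hAB (hA.trans hB.symm)] at h
  split_ifs at h with hT
  swap; · exact absurd rfl h
  obtain ⟨htr, hc⟩ := hT
  -- the elements of `A` outside `T` are in bijection, by rank, with the elements of `T ∩ B`
  have hbij : (A \ T).card = (T ∩ B).card := by
    rw [← Finset.card_image_of_injOn (f := rankIn A) (s := A \ T)
        ((rankIn_injOn A).mono (by simp)),
      ← Finset.card_image_of_injOn (f := rankIn B) (s := T ∩ B)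
        ((rankIn_injOn B).mono (by simp))]
    congr 1
    ext k
    simp only [Finset.mem_image, Finset.mem_sdiff, Finset.mem_inter]
    constructor
    · rintro ⟨a, ⟨ha, haT⟩, rfl⟩
      obtain ⟨b, hb, hr⟩ := exists_rankIn_eq (A := B) (k := rankIn A a)
        (by have := rankIn_lt_card ha; omega)
      refine ⟨b, ⟨?_, hb⟩, hr⟩
      by_contra hbT
      exact haT ((htr a ha b hb hr.symm).2 hbT)
    · rintro ⟨b, ⟨hbT, hb⟩, rfl⟩
      obtain ⟨a, ha, hr⟩ := exists_rankIn_eq (A := A) (k := rankIn B b)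
        (by have := rankIn_lt_card hb; omega)
      exact ⟨a, ⟨ha, fun haT => (htr a ha b hb hr).1 haT hbT⟩, hr⟩
  have h1 : T.card = (T \ (A ∪ B)).card + ((T ∩ A).card + (T ∩ B).card) := by
    rw [← Finset.card_union_of_disjoint, ← Finset.inter_union_distrib_left,
      Finset.card_sdiff_add_card_inter]
    exact hAB.mono Finset.inter_subset_right Finset.inter_subset_right
  have h2 : (A \ T).card + (T ∩ A).card = A.card := by
    rw [Finset.inter_comm, Finset.card_sdiff_add_card_inter]
  omega

/-! ### Permutations of the tensor factors -/

/-- The matrix commutes with all permutations of the tensor factors. -/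
def PermInvariant {n : ℕ} (M : Matrix (Finset (Fin n)) (Finset (Fin n)) ℂ) : Prop :=
  ∀ (π : Equiv.Perm (Fin n)) (I J : Finset (Fin n)),
    M (I.map π.toEmbedding) (J.map π.toEmbedding) = M I J

lemma PermInvariant.mulVec_map {n : ℕ} {M : Matrix (Finset (Fin n)) (Finset (Fin n)) ℂ}
    (hM : PermInvariant M) (π : Equiv.Perm (Fin n)) (f : Finset (Fin n) → ℂ)
    (T : Finset (Fin n)) :
    M.mulVec f (T.map π.toEmbedding) =
      M.mulVec (fun J => f (J.map π.toEmbedding)) T := by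
  simp only [Matrix.mulVec, dotProduct]
  rw [← (Equiv.finsetCongr π).sum_comp]
  refine Finset.sum_congr rfl fun J _ => ?_
  simp only [Equiv.finsetCongr_apply]
  rw [hM]

/-- The space of the vectors that are antisymmetric in each matched pair of tensor factors and
symmetric in the tensor factors outside `A ∪ B`. The vectors `v_{d,s}(A,B)` form a basis of it. -/
def pairSpace {n : ℕ} (A B : Finset (Fin n)) : Submodule ℂ (Finset (Fin n) → ℂ) where
  carrier := {f |
    (∀ a ∈ A, ∀ b ∈ B, rankIn A a = rankIn B b →
      ∀ T, f (T.map (Equiv.swap a b).toEmbedding) = -f T) ∧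
    (∀ x ∉ A ∪ B, ∀ y ∉ A ∪ B, ∀ T, f (T.map (Equiv.swap x y).toEmbedding) = f T)}
  add_mem' := by
    rintro f g ⟨hf1, hf2⟩ ⟨hg1, hg2⟩
    refine ⟨fun a ha b hb h T => ?_, fun x hx y hy T => ?_⟩
    · simp only [Pi.add_apply, hf1 a ha b hb h, hg1 a ha b hb h]; ring
    · simp only [Pi.add_apply, hf2 x hx y hy, hg2 x hx y hy]
  zero_mem' := by simp
  smul_mem' := by
    rintro c f ⟨hf1, hf2⟩
    refine ⟨fun a ha b hb h T => ?_, fun x hx y hy T => ?_⟩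
    · simp only [Pi.smul_apply, hf1 a ha b hb h, smul_neg]
    · simp only [Pi.smul_apply, hf2 x hx y hy]

lemma PermInvariant.mulVec_mem_pairSpace {n : ℕ}
    {M : Matrix (Finset (Fin n)) (Finset (Fin n)) ℂ} (hM : PermInvariant M)
    {A B : Finset (Fin n)} {f : Finset (Fin n) → ℂ} (hf : f ∈ pairSpace A B) :
    M.mulVec f ∈ pairSpace A B := by
  refine ⟨fun a ha b hb h T => ?_, fun x hx y hy T => ?_⟩
  · rw [hM.mulVec_map, show (fun J => f (J.map (Equiv.swap a b).toEmbedding)) = -f from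
      funext fun J => hf.1 a ha b hb h J, Matrix.mulVec_neg, Pi.neg_apply]
  · rw [hM.mulVec_map, show (fun J => f (J.map (Equiv.swap x y).toEmbedding)) = f from
      funext fun J => hf.2 x hx y hy J]

lemma mem_map_swap {n : ℕ} (a b x : Fin n) (T : Finset (Fin n)) :
    x ∈ T.map (Equiv.swap a b).toEmbedding ↔ Equiv.swap a b x ∈ T := by
  rw [Finset.mem_map_equiv, Equiv.symm_swap]

lemma swap_of_ne {n : ℕ} {a b : Fin n} (S : Finset (Fin n)) (ha : a ∉ S) (hb : b ∉ S) {z : Fin n}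
    (hz : z ∈ S) : Equiv.swap a b z = z :=
  Equiv.swap_apply_of_ne_of_ne (fun h => ha (h ▸ hz)) (fun h => hb (h ▸ hz))

section SwapPair

variable {n : ℕ} {A B : Finset (Fin n)} {a b : Fin n}

lemma isTransversal_map_swap (hAB : Disjoint A B) (ha : a ∈ A) (hb : b ∈ B)
    (h : rankIn A a = rankIn B b) (T : Finset (Fin n)) :
    IsTransversal A B (T.map (Equiv.swap a b).toEmbedding) ↔ IsTransversal A B T := by
  have hdis : ∀ x, x ∈ A → x ∉ B := fun x h1 h2 => Finset.disjoint_left.1 hAB h1 h2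
  refine forall₂_congr fun a' ha' => forall₂_congr fun b' hb' => imp_congr_right fun hr => ?_
  rw [mem_map_swap, mem_map_swap]
  by_cases haa : a' = a
  · subst haa
    have : b' = b := rankIn_injOn B hb' hb (hr.symm.trans h)
    subst this
    rw [Equiv.swap_apply_left, Equiv.swap_apply_right]; tauto
  · have hbb : b' ≠ b := by
      rintro rfl
      exact haa (rankIn_injOn A ha' ha (hr.trans h.symm))
    have hab' : a' ≠ b := fun h => hdis a' ha' (h ▸ hb)
    have hba' : b' ≠ a := fun h => hdis a ha (h ▸ hb')
    rw [Equiv.swap_apply_of_ne_of_ne haa hab', Equiv.swap_apply_of_ne_of_ne hba' hbb]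

lemma map_swap_sdiff (ha : a ∈ A) (hb : b ∈ B) (T : Finset (Fin n)) :
    T.map (Equiv.swap a b).toEmbedding \ (A ∪ B) = T \ (A ∪ B) := by
  ext x
  simp only [Finset.mem_sdiff, mem_map_swap]
  refine and_congr_left fun hx => ?_
  have hxa : x ≠ a := fun h => hx (h ▸ Finset.mem_union_left _ ha)
  have hxb : x ≠ b := fun h => hx (h ▸ Finset.mem_union_right _ hb)
  rw [Equiv.swap_apply_of_ne_of_ne hxa hxb]

lemma card_inter_map_swap (hAB : Disjoint A B) (ha : a ∈ A) (hb : b ∈ B)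
    {T : Finset (Fin n)} (haT : a ∈ T) (hbT : b ∉ T) :
    (T ∩ A).card = (T.map (Equiv.swap a b).toEmbedding ∩ A).card + 1 := by
  have : T ∩ A = insert a (T.map (Equiv.swap a b).toEmbedding ∩ A) := by
    ext x
    simp only [Finset.mem_inter, Finset.mem_insert, mem_map_swap]
    by_cases hxa : x = a
    · subst hxa; simp [haT, ha]
    · by_cases hxb : x = b
      · subst hxb
        simp [hxa, Finset.disjoint_right.1 hAB hb]
      · rw [Equiv.swap_apply_of_ne_of_ne hxa hxb]; simp [hxa]
  rw [this, Finset.card_insert_of_notMem]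
  simp [hbT]

lemma map_swap_map_swap (T : Finset (Fin n)) :
    (T.map (Equiv.swap a b).toEmbedding).map (Equiv.swap a b).toEmbedding = T := by
  ext x
  rw [mem_map_swap, mem_map_swap, Equiv.swap_apply_self]

end SwapPair

lemma vVec_mem_pairSpace {n : ℕ} (d s : ℕ) {A B : Finset (Fin n)} (hAB : Disjoint A B)
    (hcard : A.card = B.card) : vVec d s A B ∈ pairSpace A B := by
  classical
  refine ⟨fun a ha b hb h T => ?_, fun x hx y hy T => ?_⟩
  · rw [vVec_apply d s hAB hcard, vVec_apply d s hAB hcard, isTransversal_map_swap hAB ha hb h,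
      map_swap_sdiff ha hb]
    split_ifs with hT
    swap; · simp
    have hab := hT.1 a ha b hb h
    by_cases haT : a ∈ T
    · rw [card_inter_map_swap hAB ha hb haT (hab.1 haT), pow_succ]
      ring
    · have hbT : b ∈ T := not_not.1 fun h => haT (hab.2 h)
      have := card_inter_map_swap hAB ha hb (T := T.map (Equiv.swap a b).toEmbedding)
        (by simpa [mem_map_swap] using hbT) (by simpa [mem_map_swap] using haT)
      rw [this, map_swap_map_swap, pow_succ]
      ring
  · rw [vVec_apply d s hAB hcard, vVec_apply d s hAB hcard]
    have htr : IsTransversal A B (T.map (Equiv.swap x y).toEmbedding) ↔ IsTransversal A B T := by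
      refine forall₂_congr fun a' ha' => forall₂_congr fun b' hb' => imp_congr_right fun hr => ?_
      rw [mem_map_swap, mem_map_swap, swap_of_ne _ hx hy (Finset.mem_union_left _ ha'),
        swap_of_ne _ hx hy (Finset.mem_union_right _ hb')]
    have hA : T.map (Equiv.swap x y).toEmbedding ∩ A = T ∩ A := by
      ext z
      simp only [Finset.mem_inter, mem_map_swap]
      refine and_congr_left fun hz => ?_
      rw [swap_of_ne _ hx hy (Finset.mem_union_left _ hz)]
    have hC : (T.map (Equiv.swap x y).toEmbedding \ (A ∪ B)).card = (T \ (A ∪ B)).card := by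
      rw [← Finset.card_map (Equiv.swap x y).toEmbedding (s := T \ (A ∪ B))]
      congr 1
      ext z
      simp only [Finset.mem_sdiff, mem_map_swap]
      refine and_congr_right fun _ => not_congr ⟨fun hz => ?_, fun hz => ?_⟩
      · rwa [swap_of_ne _ hx hy hz]
      · have := swap_of_ne _ hx hy hz
        rw [Equiv.swap_apply_self] at this
        rwa [this]
    rw [htr, hA, hC]

/-! ### Coordinates in the space of a matched pair of position sets -/

/-- `A` and `B` are disjoint sets of `d` tensor positions each. -/
structure IsPairing {n : ℕ} (d : ℕ) (A B : Finset (Fin n)) : Prop where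
  disj : Disjoint A B
  cardA : A.card = d
  cardB : B.card = d

section Pairing

variable {n d : ℕ} {A B : Finset (Fin n)}

lemma IsPairing.card_eq (h : IsPairing d A B) : A.card = B.card := h.cardA.trans h.cardB.symm

lemma IsPairing.card_compl (h : IsPairing d A B) : ((A ∪ B)ᶜ).card = n - 2 * d := by
  rw [Finset.card_compl, Finset.card_union_of_disjoint h.disj, h.cardA, h.cardB, Fintype.card_fin]
  omega

lemma IsPairing.two_mul_le (h : IsPairing d A B) : 2 * d ≤ n := by
  have := Finset.card_le_univ (A ∪ B)
  rw [Finset.card_union_of_disjoint h.disj, h.cardA, h.cardB, Fintype.card_fin] at this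
  omega

lemma IsPairing.exists_right (h : IsPairing d A B) {a : Fin n} (ha : a ∈ A) :
    ∃ b ∈ B, rankIn A a = rankIn B b := by
  obtain ⟨b, hb, hr⟩ := exists_rankIn_eq (A := B) (k := rankIn A a)
    (h.card_eq ▸ rankIn_lt_card ha)
  exact ⟨b, hb, hr.symm⟩

lemma IsPairing.exists_left (h : IsPairing d A B) {b : Fin n} (hb : b ∈ B) :
    ∃ a ∈ A, rankIn A a = rankIn B b :=
  exists_rankIn_eq (h.card_eq.symm ▸ rankIn_lt_card hb)

/-- The swap of a pair contained in `T`, or disjoint from `T`, fixes `T`, so that antisymmetry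
forces the coordinate to vanish. -/
lemma apply_eq_zero_of_not_isTransversal {f : Finset (Fin n) → ℂ} (hf : f ∈ pairSpace A B)
    {T : Finset (Fin n)} (hT : ¬ IsTransversal A B T) : f T = 0 := by
  simp only [IsTransversal, not_forall] at hT
  obtain ⟨a, ha, b, hb, hr, hab⟩ := hT
  have h := hf.1 a ha b hb hr T
  have : T.map (Equiv.swap a b).toEmbedding = T := by
    ext x
    rw [mem_map_swap]
    by_cases hxa : x = a
    · subst hxa; rw [Equiv.swap_apply_left]; tauto
    · by_cases hxb : x = b
      · subst hxb; rw [Equiv.swap_apply_right]; tauto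
      · rw [Equiv.swap_apply_of_ne_of_ne hxa hxb]
  rw [this] at h
  exact self_eq_neg.1 h

lemma eq_union_sdiff (h : IsPairing d A B) {T : Finset (Fin n)} (hT : IsTransversal A B T)
    (hTA : T ∩ A = ∅) : T = B ∪ T \ (A ∪ B) := by
  ext x
  have h1 : x ∈ T → x ∉ A := fun hx hA => by
    have : x ∈ T ∩ A := Finset.mem_inter.2 ⟨hx, hA⟩
    simp [hTA] at this
  have h2 : x ∈ B → x ∈ T := fun hB => by
    obtain ⟨a, ha, hr⟩ := h.exists_left hB
    by_contra hx
    have : a ∈ T ∩ A := Finset.mem_inter.2 ⟨(hT a ha x hB hr).2 hx, ha⟩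
    simp [hTA] at this
  simp only [Finset.mem_union, Finset.mem_sdiff]
  tauto

/-- Swapping matched pairs moves all of `T ∩ A` to `B`, at the cost of a sign. -/
lemma apply_of_isTransversal (h : IsPairing d A B) {f : Finset (Fin n) → ℂ}
    (hf : f ∈ pairSpace A B) {T : Finset (Fin n)} (hT : IsTransversal A B T) :
    f T = (-1) ^ (T ∩ A).card * f (B ∪ T \ (A ∪ B)) := by
  induction hk : (T ∩ A).card generalizing T with
  | zero =>
    have := eq_union_sdiff h hT (Finset.card_eq_zero.1 hk)
    rw [← this, pow_zero, one_mul]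
  | succ k ih =>
    obtain ⟨a, ha⟩ := Finset.card_pos (s := T ∩ A).1 (by omega)
    obtain ⟨haT, ha⟩ := Finset.mem_inter.1 ha
    obtain ⟨b, hb, hr⟩ := h.exists_right ha
    have hbT := (hT a ha b hb hr).1 haT
    have hc := card_inter_map_swap h.disj ha hb haT hbT
    have := ih ((isTransversal_map_swap h.disj ha hb hr T).2 hT) (by omega)
    rw [hf.1 a ha b hb hr, map_swap_sdiff ha hb] at this
    rw [← neg_neg (f T), this]
    ring

/-- By the symmetry in the positions outside `A ∪ B`, only the number of them matters. -/
lemma apply_union_eq {f : Finset (Fin n) → ℂ} (hf : f ∈ pairSpace A B)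
    {Y Z : Finset (Fin n)} (hY : Y ⊆ (A ∪ B)ᶜ) (hZ : Z ⊆ (A ∪ B)ᶜ) (hYZ : Y.card = Z.card) :
    f (B ∪ Y) = f (B ∪ Z) := by
  induction hk : (Y \ Z).card generalizing Y with
  | zero =>
    have : Y ⊆ Z := Finset.sdiff_eq_empty_iff_subset.1 (Finset.card_eq_zero.1 hk)
    rw [Finset.eq_of_subset_of_card_le this hYZ.ge]
  | succ k ih =>
    obtain ⟨y, hy⟩ := Finset.card_pos (s := Y \ Z).1 (by omega)
    obtain ⟨z, hz⟩ : (Z \ Y).Nonempty := by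
      rw [← Finset.card_pos, ← Finset.card_sdiff_comm hYZ, hk]
      exact Nat.succ_pos k
    rw [Finset.mem_sdiff] at hy hz
    have hyc := Finset.mem_compl.1 (hY hy.1)
    have hzc := Finset.mem_compl.1 (hZ hz.1)
    have hsub : Y.map (Equiv.swap y z).toEmbedding ⊆ (A ∪ B)ᶜ := by
      intro x hx
      rw [mem_map_swap] at hx
      rw [Finset.mem_compl]
      intro hx'
      rw [swap_of_ne _ hyc hzc hx'] at hx
      exact Finset.mem_compl.1 (hY hx) hx'
    have hsd : Y.map (Equiv.swap y z).toEmbedding \ Z = (Y \ Z).erase y := by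
      ext x
      simp only [Finset.mem_sdiff, mem_map_swap, Finset.mem_erase]
      by_cases hxy : x = y
      · subst hxy; simp [hz.2]
      · by_cases hxz : x = z
        · subst hxz; simp [hz.1]
        · rw [Equiv.swap_apply_of_ne_of_ne hxy hxz]; simp [hxy]
    have := ih hsub (by rw [Finset.card_map, hYZ]) (by
      rw [hsd, Finset.card_erase_of_mem (Finset.mem_sdiff.2 hy), hk]; rfl)
    rw [← this, ← hf.2 y hyc z hzc (B ∪ Y), Finset.map_union]
    congr 2
    ext x
    rw [mem_map_swap]
    constructor
    · intro hx
      have := swap_of_ne _ hyc hzc (Finset.mem_union_right A hx)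
      rw [Equiv.swap_apply_self] at this
      rwa [this]
    · intro hx
      rwa [swap_of_ne _ hyc hzc (Finset.mem_union_right A hx)]

lemma IsPairing.exists_repSet (h : IsPairing d A B) {s : ℕ} (hs : s ∈ Finset.Icc d (n - d)) :
    ∃ R : Finset (Fin n), B ⊆ R ∧ Disjoint R A ∧ R.card = s := by
  rw [Finset.mem_Icc] at hs
  obtain ⟨Y, hY, hc⟩ := Finset.exists_subset_card_eq (s := (A ∪ B)ᶜ) (n := s - d)
    (by rw [h.card_compl]; omega)
  have hdis : ∀ x ∈ Y, x ∉ A ∧ x ∉ B := fun x hx => by simpa using hY hx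
  refine ⟨B ∪ Y, Finset.subset_union_left, ?_, ?_⟩
  · rw [Finset.disjoint_union_left]
    exact ⟨h.disj.symm, Finset.disjoint_left.2 fun x hx => (hdis x hx).1⟩
  · rw [Finset.card_union_of_disjoint (Finset.disjoint_right.2 fun x hx => (hdis x hx).2),
      h.cardB, hc]
    omega

open Classical in
/-- A chosen set of `s` positions that contains `B` and avoids `A`. The coordinate at `repSet A B s`
of a vector of `pairSpace A B` is its coefficient at `v_{d,s}(A,B)`. -/
noncomputable def repSet (A B : Finset (Fin n)) (s : ℕ) : Finset (Fin n) :=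
  if h : ∃ R : Finset (Fin n), B ⊆ R ∧ Disjoint R A ∧ R.card = s then h.choose else ∅

lemma IsPairing.repSet_spec (h : IsPairing d A B) {s : ℕ} (hs : s ∈ Finset.Icc d (n - d)) :
    B ⊆ repSet A B s ∧ Disjoint (repSet A B s) A ∧ (repSet A B s).card = s := by
  have := h.exists_repSet hs
  rw [repSet, dif_pos this]
  exact this.choose_spec

lemma IsPairing.isTransversal_repSet (h : IsPairing d A B) {s : ℕ}
    (hs : s ∈ Finset.Icc d (n - d)) : IsTransversal A B (repSet A B s) := by
  obtain ⟨h1, h2, -⟩ := h.repSet_spec hs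
  intro a ha b hb _
  have := Finset.disjoint_right.1 h2 ha
  have := h1 hb
  tauto

lemma IsPairing.card_repSet_sdiff (h : IsPairing d A B) {s : ℕ}
    (hs : s ∈ Finset.Icc d (n - d)) : (repSet A B s \ (A ∪ B)).card = s - d := by
  obtain ⟨h1, h2, h3⟩ := h.repSet_spec hs
  have : repSet A B s \ (A ∪ B) = repSet A B s \ B := by
    ext x
    have hx : x ∈ repSet A B s → x ∉ A := fun h' => Finset.disjoint_left.1 h2 h'
    simp only [Finset.mem_sdiff, Finset.mem_union]
    tauto
  rw [this, Finset.card_sdiff_of_subset h1, h3, h.cardB]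

lemma IsPairing.vVec_repSet (h : IsPairing d A B) {s t : ℕ} (hs : s ∈ Finset.Icc d (n - d))
    (ht : t ∈ Finset.Icc d (n - d)) :
    vVec d s A B (repSet A B t) = if s = t then 1 else 0 := by
  rw [vVec_apply d s h.disj h.card_eq, h.card_repSet_sdiff ht,
    Finset.disjoint_iff_inter_eq_empty.1 (h.repSet_spec ht).2.1]
  rw [Finset.mem_Icc] at hs ht
  have : t - d = s - d ↔ s = t := by omega
  simp [h.isTransversal_repSet (Finset.mem_Icc.2 ht), this]

/-- The vectors `v_{d,s}(A,B)` span `pairSpace A B`, with the coordinates given by `repSet`. -/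
lemma IsPairing.eq_sum (h : IsPairing d A B) {f : Finset (Fin n) → ℂ}
    (hf : f ∈ pairSpace A B) :
    f = ∑ s ∈ Finset.Icc d (n - d), f (repSet A B s) • vVec d s A B := by
  classical
  ext T
  simp only [Finset.sum_apply, Pi.smul_apply, smul_eq_mul, vVec_apply d _ h.disj h.card_eq]
  by_cases hT : IsTransversal A B T
  · have hc : (T \ (A ∪ B)).card ≤ n - 2 * d := by
      rw [← h.card_compl]
      exact Finset.card_le_card fun x hx => by simpa using (Finset.mem_sdiff.1 hx).2
    have h2 := h.two_mul_le
    have hmem : d + (T \ (A ∪ B)).card ∈ Finset.Icc d (n - d) := by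
      rw [Finset.mem_Icc]; omega
    rw [Finset.sum_eq_single_of_mem _ hmem]
    · rw [if_pos ⟨hT, by omega⟩, apply_of_isTransversal h hf hT, mul_comm]
      congr 1
      rw [apply_of_isTransversal h hf (h.isTransversal_repSet hmem),
        Finset.disjoint_iff_inter_eq_empty.1 (h.repSet_spec hmem).2.1, Finset.card_empty, pow_zero,
        one_mul]
      refine apply_union_eq hf ?_ ?_ ?_
      · exact fun x hx => by simpa using (Finset.mem_sdiff.1 hx).2
      · exact fun x hx => by simpa using (Finset.mem_sdiff.1 hx).2
      · rw [h.card_repSet_sdiff hmem]; omega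
    · intro s hs hne
      rw [Finset.mem_Icc] at hs
      rw [if_neg (by omega), mul_zero]
  · rw [apply_eq_zero_of_not_isTransversal hf hT]
    simp [hT]

lemma IsPairing.vVec_mem (h : IsPairing d A B) (s : ℕ) : vVec d s A B ∈ pairSpace A B :=
  vVec_mem_pairSpace d s h.disj h.card_eq

lemma IsPairing.vVec_eq_zero (h : IsPairing d A B) {s : ℕ} (hs : d ≤ s) {T : Finset (Fin n)}
    (hT : T.card ≠ s) : vVec d s A B T = 0 := by
  by_contra hne
  exact hT (card_of_vVec_ne_zero h.disj h.cardA h.cardB hs hne)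

/-- The image of `v_{d,s}(A,B)` under a permutation-invariant matrix that maps it to a vector
supported on the subsets of size `t`. -/
lemma IsPairing.mulVec_eq_smul (h : IsPairing d A B)
    {M : Matrix (Finset (Fin n)) (Finset (Fin n)) ℂ} (hM : PermInvariant M) {s t : ℕ}
    (ht : t ∈ Finset.Icc d (n - d))
    (hsupp : ∀ T : Finset (Fin n), T.card ≠ t → M.mulVec (vVec d s A B) T = 0) :
    M.mulVec (vVec d s A B) = M.mulVec (vVec d s A B) (repSet A B t) • vVec d t A B := by
  conv_lhs => rw [h.eq_sum (hM.mulVec_mem_pairSpace (h.vVec_mem s))]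
  refine Finset.sum_eq_single_of_mem t ht fun u hu hut => ?_
  rw [hsupp _ (by rw [(h.repSet_spec hu).2.2]; exact hut), zero_smul]

/-- The trace of the restriction to `pairSpace A B` of a permutation-invariant matrix. -/
noncomputable def pairTrace (d : ℕ) (A B : Finset (Fin n))
    (M : Matrix (Finset (Fin n)) (Finset (Fin n)) ℂ) : ℂ :=
  ∑ s ∈ Finset.Icc d (n - d), M.mulVec (vVec d s A B) (repSet A B s)

lemma IsPairing.pairTrace_mul_comm (h : IsPairing d A B)
    {M N : Matrix (Finset (Fin n)) (Finset (Fin n)) ℂ} (hM : PermInvariant M)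
    (hN : PermInvariant N) : pairTrace d A B (M * N) = pairTrace d A B (N * M) := by
  have key : ∀ {M N : Matrix (Finset (Fin n)) (Finset (Fin n)) ℂ}, PermInvariant M →
      PermInvariant N → pairTrace d A B (M * N) =
        ∑ s ∈ Finset.Icc d (n - d), ∑ t ∈ Finset.Icc d (n - d),
          N.mulVec (vVec d s A B) (repSet A B t) * M.mulVec (vVec d t A B) (repSet A B s) := by
    intro M N hM hN
    refine Finset.sum_congr rfl fun s _ => ?_
    rw [← Matrix.mulVec_mulVec]
    conv_lhs => rw [h.eq_sum (hN.mulVec_mem_pairSpace (h.vVec_mem s))]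
    rw [Matrix.mulVec_sum, Finset.sum_apply]
    refine Finset.sum_congr rfl fun t _ => ?_
    rw [Matrix.mulVec_smul, Pi.smul_apply, smul_eq_mul]
  rw [key hM hN, key hN hM, Finset.sum_comm]
  refine Finset.sum_congr rfl fun s _ => Finset.sum_congr rfl fun t _ => mul_comm _ _

end Pairing

/-! ### Tensor powers -/

lemma sum_finset_prod_ite {n : ℕ} (F : Fin n → Fin 2 → ℂ) :
    ∑ K : Finset (Fin n), ∏ k, F k (if k ∈ K then 0 else 1) = ∏ k, ∑ x, F k x := by
  simp only [Fin.sum_univ_two]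
  rw [Finset.prod_add, Finset.powerset_univ]
  refine Finset.sum_congr rfl fun K _ => ?_
  rw [← Finset.prod_mul_prod_compl K, Finset.compl_eq_univ_sdiff]
  congr 1
  · exact Finset.prod_congr rfl fun k hk => by rw [if_pos hk]
  · exact Finset.prod_congr rfl fun k hk => by rw [if_neg (Finset.mem_sdiff.1 hk).2]

lemma tensorPower_mul (n : ℕ) (M N : Matrix (Fin 2) (Fin 2) ℂ) :
    tensorPower n (M * N) = tensorPower n M * tensorPower n N := by
  ext I J
  simp only [tensorPower, Matrix.of_apply, Matrix.mul_apply, ← Finset.prod_mul_distrib]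
  exact (sum_finset_prod_ite fun k x =>
    M (if k ∈ I then 0 else 1) x * N x (if k ∈ J then 0 else 1)).symm

lemma tensorPower_diagonal (n : ℕ) (a b : ℂ) :
    tensorPower n (Matrix.diagonal ![a, b]) =
      Matrix.diagonal fun I : Finset (Fin n) => a ^ I.card * b ^ (n - I.card) := by
  ext I J
  simp only [tensorPower, Matrix.of_apply]
  by_cases hIJ : I = J
  · subst hIJ
    have h1 : ∏ k ∈ I, Matrix.diagonal ![a, b] (if k ∈ I then 0 else 1) (if k ∈ I then 0 else 1) =
        a ^ I.card := Finset.prod_eq_pow_card fun k hk => by simp [hk]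
    have h2 : ∏ k ∈ Iᶜ, Matrix.diagonal ![a, b] (if k ∈ I then 0 else 1) (if k ∈ I then 0 else 1) =
        b ^ (n - I.card) := by
      rw [Finset.prod_eq_pow_card (b := b) fun k hk => by simp [Finset.mem_compl.1 hk],
        Finset.card_compl, Fintype.card_fin]
    rw [Matrix.diagonal_apply_eq, ← Finset.prod_mul_prod_compl I, h1, h2]
  · rw [Matrix.diagonal_apply_ne _ hIJ]
    obtain ⟨k, hk⟩ : ∃ k, ¬ (k ∈ I ↔ k ∈ J) := by
      by_contra h
      push Not at h
      exact hIJ (Finset.ext h)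
    refine Finset.prod_eq_zero (Finset.mem_univ k) (Matrix.diagonal_apply_ne _ ?_)
    by_cases h1 : k ∈ I <;> by_cases h2 : k ∈ J <;> simp_all

lemma tensorPower_one (n : ℕ) : tensorPower n 1 = 1 := by
  have : (1 : Matrix (Fin 2) (Fin 2) ℂ) = Matrix.diagonal ![1, 1] := by
    rw [← Matrix.diagonal_one]
    congr 1
    ext i; fin_cases i <;> rfl
  rw [this, tensorPower_diagonal]
  simp

lemma tensorPower_conjTranspose (n : ℕ) (M : Matrix (Fin 2) (Fin 2) ℂ) :
    tensorPower n M.conjTranspose = (tensorPower n M).conjTranspose := by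
  ext I J
  simp [tensorPower, Matrix.conjTranspose_apply]

lemma permInvariant_tensorPower (n : ℕ) (M : Matrix (Fin 2) (Fin 2) ℂ) :
    PermInvariant (tensorPower n M) := by
  intro π I J
  simp only [tensorPower, Matrix.of_apply]
  rw [← Equiv.prod_comp π]
  simp

/-! ### Rotations of the Bloch ball -/

lemma qubit_conjTranspose (p : EuclideanSpace ℝ (Fin 3)) :
    (qubit p).conjTranspose = qubit p := by
  ext i j
  fin_cases i <;> fin_cases j <;> simp [qubit, Matrix.conjTranspose_apply, sub_eq_add_neg]

lemma qubit_trace (p : EuclideanSpace ℝ (Fin 3)) : (qubit p).trace = 1 := by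
  simp [qubit, Matrix.trace_fin_two]
  ring

lemma qubit_det (p : EuclideanSpace ℝ (Fin 3)) : (qubit p).det = ((1 - ‖p‖ ^ 2) / 4 : ℝ) := by
  rw [EuclideanSpace.norm_sq_eq, Fin.sum_univ_three]
  simp [qubit, Matrix.det_fin_two]
  linear_combination (1 / 4 * (p.ofLp 1 : ℂ) ^ 2) * (Complex.I_sq)

/-- A Hermitian matrix of trace one is the `qubit` of its Bloch vector. -/
lemma eq_qubit {M : Matrix (Fin 2) (Fin 2) ℂ} (hM : M.conjTranspose = M) (htr : M.trace = 1) :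
    M = qubit !₂[2 * (M 1 0).re, 2 * (M 1 0).im, 2 * (M 0 0).re - 1] := by
  have h (i j) : star (M j i) = M i j := by
    rw [← Matrix.conjTranspose_apply, hM]
  rw [Matrix.trace_fin_two] at htr
  have h00 := h 0 0
  have h11 := h 1 1
  have h01 := h 0 1
  simp only [Complex.ext_iff] at h00 h11 h01 htr
  simp at h00 h11 h01 htr
  ext i j
  fin_cases i <;> fin_cases j <;> simp [qubit, Complex.ext_iff]
  · linarith
  · constructor <;> linarith
  · constructor <;> linarith

/-- Conjugation of a qubit state by a unitary matrix acts on the Bloch vector as a linear isometry: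
it is linear, and it preserves the norm because the determinant of the state determines it. -/
lemma exists_isometry_qubit {U : Matrix (Fin 2) (Fin 2) ℂ}
    (hU : U * U.conjTranspose = 1) (hU' : U.conjTranspose * U = 1) :
    ∃ R : EuclideanSpace ℝ (Fin 3) ≃ₗᵢ[ℝ] EuclideanSpace ℝ (Fin 3),
      ∀ p, qubit (R p) = U * qubit p * U.conjTranspose := by
  set N : EuclideanSpace ℝ (Fin 3) → Matrix (Fin 2) (Fin 2) ℂ :=
    fun p => U * qubit p * U.conjTranspose with hN
  have hherm : ∀ p, (N p).conjTranspose = N p := fun p => by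
    simp [hN, Matrix.conjTranspose_mul, qubit_conjTranspose, Matrix.mul_assoc]
  have htr : ∀ p, (N p).trace = 1 := fun p => by
    simp only [hN]
    rw [Matrix.trace_mul_comm, ← Matrix.mul_assoc, hU', Matrix.one_mul, qubit_trace]
  -- the affine structure of `qubit`, written without division
  have hadd : ∀ p q, N (p + q) = N p + N q - (1 / 2 : ℂ) • 1 := fun p q => by
    have : qubit (p + q) = qubit p + qubit q - (1 / 2 : ℂ) • 1 := by
      ext i j
      fin_cases i <;> fin_cases j <;> simp [qubit] <;> ring
    simp only [hN, this, Matrix.mul_sub, Matrix.sub_mul, Matrix.mul_add, Matrix.add_mul,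
      Matrix.mul_smul, Matrix.smul_mul, Matrix.mul_one, hU]
  have hsmul : ∀ (c : ℝ) p, N (c • p) = (c : ℂ) • N p + ((1 - c) / 2 : ℂ) • 1 := fun c p => by
    have : qubit (c • p) = (c : ℂ) • qubit p + ((1 - c) / 2 : ℂ) • 1 := by
      ext i j
      fin_cases i <;> fin_cases j <;> simp [qubit] <;> ring
    simp only [hN, this, Matrix.mul_add, Matrix.add_mul,
      Matrix.mul_smul, Matrix.smul_mul, Matrix.mul_one, hU]
  let L : EuclideanSpace ℝ (Fin 3) →ₗ[ℝ] EuclideanSpace ℝ (Fin 3) :=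
    { toFun := fun p => !₂[2 * (N p 1 0).re, 2 * (N p 1 0).im, 2 * (N p 0 0).re - 1]
      map_add' := fun p q => by
        ext i
        fin_cases i <;> simp [hadd] <;> ring
      map_smul' := fun c p => by
        ext i
        fin_cases i <;> simp [hsmul] <;> ring }
  have hL : ∀ p, qubit (L p) = N p := fun p => (eq_qubit (hherm p) (htr p)).symm
  have hnorm : ∀ p, ‖L p‖ = ‖p‖ := fun p => by
    have h1 : (qubit (L p)).det = (qubit p).det := by
      rw [hL, hN, Matrix.det_mul_comm, ← Matrix.mul_assoc, hU', Matrix.one_mul]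
    rw [qubit_det, qubit_det, Complex.ofReal_inj] at h1
    have h2 : ‖L p‖ ^ 2 = ‖p‖ ^ 2 := by linarith
    exact (pow_left_inj₀ (norm_nonneg _) (norm_nonneg _) two_ne_zero).1 h2
  exact ⟨(LinearIsometry.mk L hnorm).toLinearIsometryEquiv rfl, fun p => hL p⟩

/-- Diagonalization of a qubit state. The eigenvalues are not sorted, so `t` may be `-‖p‖`. -/
lemma exists_unitary_qubit (p : EuclideanSpace ℝ (Fin 3)) :
    ∃ (U : Matrix (Fin 2) (Fin 2) ℂ) (t : ℝ), U * U.conjTranspose = 1 ∧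
      U.conjTranspose * U = 1 ∧ (t = ‖p‖ ∨ t = -‖p‖) ∧
      qubit p = U * Matrix.diagonal ![(((1 + t) / 2 : ℝ) : ℂ), (((1 - t) / 2 : ℝ) : ℂ)] *
        U.conjTranspose := by
  have hH : (qubit p).IsHermitian := qubit_conjTranspose p
  have htr := hH.trace_eq_sum_eigenvalues
  have hdet := hH.det_eq_prod_eigenvalues
  rw [qubit_trace, Fin.sum_univ_two] at htr
  rw [qubit_det, Fin.prod_univ_two] at hdet
  set e := hH.eigenvalues with he
  have htr' : e 0 + e 1 = 1 := Complex.ofReal_injective (by simpa using htr.symm)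
  have hdet' : (1 - ‖p‖ ^ 2) / 4 = e 0 * e 1 := Complex.ofReal_injective (by simpa using hdet)
  have hU := hH.eigenvectorUnitary.2
  refine ⟨hH.eigenvectorUnitary, e 0 - e 1, (Matrix.mem_unitaryGroup_iff.1 hU),
    (Matrix.mem_unitaryGroup_iff'.1 hU), ?_, ?_⟩
  · refine sq_eq_sq_iff_eq_or_eq_neg.1 ?_
    have h1 : e 1 = 1 - e 0 := by linarith
    rw [h1] at hdet' ⊢
    linear_combination 4 * hdet'
  · conv_lhs => rw [hH.spectral_theorem, Unitary.conjStarAlgAut_apply]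
    have : ((RCLike.ofReal ∘ hH.eigenvalues : Fin 2 → ℂ)) =
        ![(((1 + (e 0 - e 1)) / 2 : ℝ) : ℂ), (((1 - (e 0 - e 1)) / 2 : ℝ) : ℂ)] := by
      rw [show (1 + (e 0 - e 1)) / 2 = e 0 by linarith,
        show (1 - (e 0 - e 1)) / 2 = e 1 by linarith]
      ext i
      fin_cases i <;> simp [he]
    rw [this]
    rfl

/-! ### The averaged state on the space of a matched pair of position sets -/

/-- The trace of the restriction of `ρ^{⊗n}` to `pairSpace A B`, for `|A| = |B| = d` and `‖p‖ = r`: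
the sum of `λ₊^s λ₋^(n-s)` over `d ≤ s ≤ n - d`, where `λ± = (1 ± r) / 2`. -/
noncomputable def eigenWeight (n d : ℕ) (r : ℝ) : ℝ :=
  ∑ s ∈ Finset.Icc d (n - d), ((1 + r) / 2) ^ s * ((1 - r) / 2) ^ (n - s)

lemma eigenWeight_neg {n d : ℕ} (hd : 2 * d ≤ n) (r : ℝ) :
    eigenWeight n d (-r) = eigenWeight n d r := by
  refine Finset.sum_nbij' (fun s => n - s) (fun s => n - s) ?_ ?_ ?_ ?_ ?_
  · intro s hs; rw [Finset.mem_Icc] at hs ⊢; omega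
  · intro s hs; rw [Finset.mem_Icc] at hs ⊢; omega
  · intro s hs; rw [Finset.mem_Icc] at hs; omega
  · intro s hs; rw [Finset.mem_Icc] at hs; omega
  · intro s hs
    rw [Finset.mem_Icc] at hs
    rw [show n - (n - s) = s by omega, mul_comm, sub_neg_eq_add, ← sub_eq_add_neg]

lemma eigenWeight_zero {n d : ℕ} (hd : 2 * d ≤ n) :
    eigenWeight n d 0 = ((n : ℝ) - 2 * d + 1) * (1 / 2 ^ n) := by
  have hterm : ∀ s ∈ Finset.Icc d (n - d),
      ((1 + 0 : ℝ) / 2) ^ s * ((1 - 0) / 2) ^ (n - s) = 1 / 2 ^ n := by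
    intro s hs
    rw [Finset.mem_Icc] at hs
    rw [add_zero, sub_zero, ← pow_add, show s + (n - s) = n by omega, one_div, one_div, inv_pow]
  rw [eigenWeight, Finset.sum_congr rfl hterm, Finset.sum_const, Nat.card_Icc, nsmul_eq_mul,
    show n - d + 1 - d = n - 2 * d + 1 by omega]
  push_cast [Nat.cast_sub hd]
  ring

lemma IsPairing.pairTrace_tensorPower_qubit {n d : ℕ} {A B : Finset (Fin n)}
    (h : IsPairing d A B) (p : EuclideanSpace ℝ (Fin 3)) :
    pairTrace d A B (tensorPower n (qubit p)) = eigenWeight n d ‖p‖ := by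
  obtain ⟨U, t, -, hU', ht, hp⟩ := exists_unitary_qubit p
  have ht' : eigenWeight n d ‖p‖ = eigenWeight n d t := by
    rcases ht with rfl | rfl
    · rfl
    · exact (eigenWeight_neg h.two_mul_le _).symm
  rw [hp, Matrix.mul_assoc, tensorPower_mul, h.pairTrace_mul_comm (permInvariant_tensorPower n _)
    (permInvariant_tensorPower n _), ← tensorPower_mul, Matrix.mul_assoc, hU', Matrix.mul_one,
    tensorPower_diagonal, ht', eigenWeight, Complex.ofReal_sum]
  refine Finset.sum_congr rfl fun s hs => ?_
  rw [Matrix.mulVec_diagonal, (h.repSet_spec hs).2.2, h.vVec_repSet hs hs, if_pos rfl, mul_one]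
  push_cast
  ring

section Average

variable {n : ℕ} {w : EuclideanSpace ℝ (Fin 3) → ℝ} {g : ℝ → ℝ}

lemma continuous_tensorPower_qubit (n : ℕ) (I J : Finset (Fin n)) :
    Continuous fun p : EuclideanSpace ℝ (Fin 3) => tensorPower n (qubit p) I J := by
  have h : ∀ i j : Fin 2, Continuous fun p : EuclideanSpace ℝ (Fin 3) => qubit p i j := by
    intro i j
    fin_cases i <;> fin_cases j <;> simp [qubit] <;> fun_prop
  simp only [tensorPower, Matrix.of_apply]
  exact continuous_finsetProd _ fun k _ => h _ _

lemma integrableOn_tensorPower_mul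
    (hint : IntegrableOn w (Metric.closedBall (0 : EuclideanSpace ℝ (Fin 3)) 1) volume)
    (I J : Finset (Fin n)) :
    IntegrableOn (fun p => tensorPower n (qubit p) I J * (w p : ℂ))
      (Metric.closedBall (0 : EuclideanSpace ℝ (Fin 3)) 1) volume :=
  IntegrableOn.continuousOn_mul (continuous_tensorPower_qubit n I J).continuousOn
    (Integrable.ofReal hint) (isCompact_closedBall _ _)

/-- Averaging commutes with linear functionals. -/
lemma map_averageState
    (hint : IntegrableOn w (Metric.closedBall (0 : EuclideanSpace ℝ (Fin 3)) 1) volume)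
    (l : Matrix (Finset (Fin n)) (Finset (Fin n)) ℂ →ₗ[ℂ] ℂ) :
    l (averageState n w) = ∫ p in Metric.closedBall (0 : EuclideanSpace ℝ (Fin 3)) 1,
      l (tensorPower n (qubit p)) * (w p : ℂ) := by
  have hl : ∀ M : Matrix (Finset (Fin n)) (Finset (Fin n)) ℂ,
      l M = ∑ I, ∑ J, l (Matrix.single I J 1) * M I J := by
    intro M
    conv_lhs => rw [Matrix.matrix_eq_sum_single M]
    simp only [map_sum]
    refine Finset.sum_congr rfl fun I _ => Finset.sum_congr rfl fun J _ => ?_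
    rw [← mul_one (M I J), ← smul_eq_mul, ← Matrix.smul_single, map_smul, smul_eq_mul,
      smul_eq_mul, mul_one, mul_comm]
  rw [hl]
  simp_rw [hl (tensorPower n _), Finset.sum_mul, mul_assoc]
  rw [integral_finsetSum _ fun I _ => integrable_finsetSum _ fun J _ =>
    (integrableOn_tensorPower_mul hint I J).const_mul _]
  refine Finset.sum_congr rfl fun I _ => ?_
  rw [integral_finsetSum _ fun J _ => (integrableOn_tensorPower_mul hint I J).const_mul _]
  refine Finset.sum_congr rfl fun J _ => ?_
  rw [integral_const_mul]
  rfl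

lemma averageState_conj
    (hint : IntegrableOn w (Metric.closedBall (0 : EuclideanSpace ℝ (Fin 3)) 1) volume)
    (hrad : ∀ p ∈ Metric.closedBall (0 : EuclideanSpace ℝ (Fin 3)) 1, w p = g ‖p‖)
    {U : Matrix (Fin 2) (Fin 2) ℂ} (hU : U * U.conjTranspose = 1)
    (hU' : U.conjTranspose * U = 1) :
    tensorPower n U * averageState n w * tensorPower n U.conjTranspose = averageState n w := by
  obtain ⟨R, hR⟩ := exists_isometry_qubit hU hU'
  ext I J
  have h := map_averageState (n := n) hint
    { toFun := fun M => (tensorPower n U * M * tensorPower n U.conjTranspose) I J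
      map_add' := fun M N => by simp [Matrix.mul_add, Matrix.add_mul]
      map_smul' := fun c M => by simp }
  simp only [LinearMap.coe_mk, AddHom.coe_mk, ← tensorPower_mul, ← hR] at h
  rw [h]
  have hpre : R ⁻¹' Metric.closedBall 0 1 = Metric.closedBall 0 1 := by
    ext p; simp
  have h2 := R.measurePreserving.setIntegral_preimage_emb R.toHomeomorph.measurableEmbedding
    (fun p => tensorPower n (qubit p) I J * (w p : ℂ)) (Metric.closedBall 0 1)
  rw [hpre] at h2
  rw [averageState, Matrix.of_apply, ← h2]
  refine setIntegral_congr_fun measurableSet_closedBall fun p hp => ?_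
  have hp' : R p ∈ Metric.closedBall (0 : EuclideanSpace ℝ (Fin 3)) 1 := by simpa using hp
  simp only [hrad p hp, hrad _ hp', R.norm_map]

lemma averageState_commute
    (hint : IntegrableOn w (Metric.closedBall (0 : EuclideanSpace ℝ (Fin 3)) 1) volume)
    (hrad : ∀ p ∈ Metric.closedBall (0 : EuclideanSpace ℝ (Fin 3)) 1, w p = g ‖p‖)
    {U : Matrix (Fin 2) (Fin 2) ℂ} (hU : U * U.conjTranspose = 1)
    (hU' : U.conjTranspose * U = 1) : Commute (averageState n w) (tensorPower n U) := by
  have h := averageState_conj (n := n) hint hrad hU hU'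
  rw [commute_iff_eq]
  conv_lhs => rw [← h]
  rw [Matrix.mul_assoc, ← tensorPower_mul, hU', tensorPower_one, Matrix.mul_one]

/-- Invariance under the rotations about the `z`-axis makes the averaged state block diagonal. -/
lemma averageState_eq_zero
    (hint : IntegrableOn w (Metric.closedBall (0 : EuclideanSpace ℝ (Fin 3)) 1) volume)
    (hrad : ∀ p ∈ Metric.closedBall (0 : EuclideanSpace ℝ (Fin 3)) 1, w p = g ‖p‖)
    {I J : Finset (Fin n)} (hIJ : I.card ≠ J.card) : averageState n w I J = 0 := by
  -- a phase `u` with `u ^ |I| * conj u ^ |J| = -1`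
  set θ : ℝ := Real.pi / ((I.card : ℝ) - J.card) with hθ
  set u : ℂ := Complex.exp (θ * Complex.I) with hu
  have hustar : star u = Complex.exp (-(θ * Complex.I)) := by
    rw [hu, Complex.star_def, ← Complex.exp_conj]
    simp
  have huu : u * star u = 1 := by
    rw [hustar, hu, ← Complex.exp_add, add_neg_cancel, Complex.exp_zero]
  have hconj : (Matrix.diagonal ![u, 1]).conjTranspose = Matrix.diagonal ![star u, 1] := by
    rw [Matrix.diagonal_conjTranspose]
    congr 1
    ext i; fin_cases i <;> simp
  have hone : Matrix.diagonal (![1, 1] : Fin 2 → ℂ) = 1 := by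
    rw [← Matrix.diagonal_one]
    congr 1
    ext i; fin_cases i <;> rfl
  have hU : Matrix.diagonal ![u, 1] * (Matrix.diagonal ![u, 1]).conjTranspose = 1 := by
    rw [hconj, Matrix.diagonal_mul_diagonal, ← hone]
    congr 1
    ext i; fin_cases i
    · exact huu
    · exact one_mul 1
  have h := averageState_conj (n := n) hint hrad hU (mul_eq_one_comm.1 hU)
  rw [hconj, tensorPower_diagonal, tensorPower_diagonal] at h
  have h2 := congrFun (congrFun h I) J
  rw [Matrix.mul_diagonal, Matrix.diagonal_mul] at h2
  simp only [one_pow, mul_one] at h2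
  have h3 : u ^ I.card * star u ^ J.card = -1 := by
    rw [hustar, hu, ← Complex.exp_nat_mul, ← Complex.exp_nat_mul, ← Complex.exp_add,
      ← Complex.exp_pi_mul_I]
    congr 1
    have hne : (I.card : ℂ) - J.card ≠ 0 := by
      rw [sub_ne_zero]; exact_mod_cast hIJ
    rw [hθ]
    push_cast
    field_simp
    ring
  have h4 : averageState n w I J = -averageState n w I J := by
    linear_combination averageState n w I J * h3 - h2
  exact self_eq_neg.1 h4

lemma permInvariant_averageState (n : ℕ) (w : EuclideanSpace ℝ (Fin 3) → ℝ) :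
    PermInvariant (averageState n w) := by
  intro π I J
  simp only [averageState, Matrix.of_apply, permInvariant_tensorPower n _ π I J]

/-- The Hadamard matrix, a rotation that exchanges the `x`- and the `z`-axis. -/
noncomputable def hadamardGate : Matrix (Fin 2) (Fin 2) ℂ :=
  (((Real.sqrt 2)⁻¹ : ℝ) : ℂ) • !![1, 1; 1, -1]

lemma hadamardGate_conjTranspose : hadamardGate.conjTranspose = hadamardGate := by
  ext i j
  fin_cases i <;> fin_cases j <;> simp [hadamardGate, Matrix.conjTranspose_apply]

lemma hadamardGate_mul_self : hadamardGate * hadamardGate = 1 := by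
  have h : (((Real.sqrt 2)⁻¹ : ℝ) : ℂ) * (((Real.sqrt 2)⁻¹ : ℝ) : ℂ) = 1 / 2 := by
    rw [← Complex.ofReal_mul, ← mul_inv, Real.mul_self_sqrt zero_le_two]
    simp
  rw [hadamardGate, Matrix.smul_mul, Matrix.mul_smul, smul_smul, h]
  ext i j
  fin_cases i <;> fin_cases j <;> simp <;> norm_num

lemma tensorPower_hadamardGate (n : ℕ) (I J : Finset (Fin n)) :
    tensorPower n hadamardGate I J =
      (((Real.sqrt 2)⁻¹ : ℝ) : ℂ) ^ n * (-1) ^ (Iᶜ ∩ Jᶜ).card := by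
  have h : ∀ k : Fin n, hadamardGate (if k ∈ I then 0 else 1) (if k ∈ J then 0 else 1) =
      (((Real.sqrt 2)⁻¹ : ℝ) : ℂ) * (if k ∈ Iᶜ ∩ Jᶜ then -1 else 1) := by
    intro k
    by_cases h1 : k ∈ I <;> by_cases h2 : k ∈ J <;> simp [hadamardGate, h1, h2]
  simp only [tensorPower, Matrix.of_apply, h, Finset.prod_mul_distrib, Finset.prod_const,
    Finset.card_univ, Fintype.card_fin]
  rw [Finset.prod_ite_mem, Finset.univ_inter, Finset.prod_const]

/-- The Hadamard rotation of `v_{d,n-d}(A,B)` has a nonzero component along each `v_{d,s}(A,B)`. -/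
lemma IsPairing.hadamard_ne_zero {d : ℕ} {A B : Finset (Fin n)} (h : IsPairing d A B) {s : ℕ}
    (hs : s ∈ Finset.Icc d (n - d)) :
    (tensorPower n hadamardGate).mulVec (vVec d (n - d) A B) (repSet A B s) ≠ 0 := by
  classical
  have hd := h.two_mul_le
  have htop : n - d ∈ Finset.Icc d (n - d) := by rw [Finset.mem_Icc]; omega
  obtain ⟨hR1, hR2, -⟩ := h.repSet_spec hs
  -- all nonzero terms of the sum have the same sign
  have hterm : ∀ J : Finset (Fin n),
      tensorPower n hadamardGate (repSet A B s) J * vVec d (n - d) A B J =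
        ((((Real.sqrt 2)⁻¹ : ℝ) : ℂ) ^ n * (-1) ^ d) *
          (if vVec d (n - d) A B J ≠ 0 then 1 else 0) := by
    intro J
    by_cases hJ : vVec d (n - d) A B J = 0
    · rw [hJ, mul_zero, if_neg (not_not_intro rfl), mul_zero]
    rw [if_pos hJ, tensorPower_hadamardGate]
    have hT : IsTransversal A B J ∧ (J \ (A ∪ B)).card = n - d - d := by
      by_contra hT
      exact hJ (by rw [vVec_apply d (n - d) h.disj h.card_eq, if_neg hT])
    rw [vVec_apply d (n - d) h.disj h.card_eq, if_pos hT]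
    have hC : J \ (A ∪ B) = (A ∪ B)ᶜ := by
      refine Finset.eq_of_subset_of_card_le (fun x hx => ?_) ?_
      · simpa using (Finset.mem_sdiff.1 hx).2
      · rw [hT.2, h.card_compl]; omega
    have hset : (repSet A B s)ᶜ ∩ Jᶜ = A \ J := by
      ext x
      have h1 : x ∈ B → x ∈ repSet A B s := fun hx => hR1 hx
      have h2 : x ∈ A → x ∉ repSet A B s := fun hx => Finset.disjoint_right.1 hR2 hx
      have h3 := Finset.ext_iff.1 hC x
      simp only [Finset.mem_sdiff, Finset.mem_union, Finset.mem_compl, Finset.mem_inter] at h3 ⊢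
      constructor
      · rintro ⟨hR, hJ⟩
        exact ⟨by_contra fun hA => hJ (h3.2 (not_or.2 ⟨hA, fun hB => hR (h1 hB)⟩)).1, hJ⟩
      · rintro ⟨hA, hJ⟩
        exact ⟨h2 hA, hJ⟩
    have hcard : (A \ J).card + (J ∩ A).card = d := by
      rw [Finset.inter_comm, Finset.card_sdiff_add_card_inter, h.cardA]
    rw [hset, mul_one, mul_assoc, ← pow_add (-1 : ℂ), hcard]
  have hsum : (tensorPower n hadamardGate).mulVec (vVec d (n - d) A B) (repSet A B s) =
      ((((Real.sqrt 2)⁻¹ : ℝ) : ℂ) ^ n * (-1) ^ d) *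
        (({J : Finset (Fin n) | vVec d (n - d) A B J ≠ 0} : Finset _).card : ℂ) := by
    rw [Matrix.mulVec, dotProduct, Finset.sum_congr rfl fun J _ => hterm J, ← Finset.mul_sum,
      Finset.sum_boole]
  rw [hsum]
  refine mul_ne_zero (mul_ne_zero (pow_ne_zero _ ?_) (pow_ne_zero _ (by simp))) ?_
  · simp
  · rw [Nat.cast_ne_zero, Finset.card_ne_zero]
    refine ⟨repSet A B (n - d), ?_⟩
    rw [Finset.mem_filter_univ, h.vVec_repSet htop htop]
    simp

/-- The eigenvalue `λ_d` of the averaged state, as the average over the unit ball of the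
normalized trace of `ρ^{⊗n}` on a space `pairSpace A B`. -/
noncomputable def ballEigenvalue (n : ℕ) (w : EuclideanSpace ℝ (Fin 3) → ℝ) (d : ℕ) : ℝ :=
  ((n : ℝ) - 2 * d + 1)⁻¹ *
    ∫ p in Metric.closedBall (0 : EuclideanSpace ℝ (Fin 3)) 1, eigenWeight n d ‖p‖ * w p

/-- The averaged state acts as the scalar `λ_d` on each space `pairSpace A B`: it is diagonal in
the basis `v_{d,s}(A,B)`, and it commutes with the Hadamard rotation, which mixes all of them. -/
theorem IsPairing.averageState_mulVec {d : ℕ} {A B : Finset (Fin n)} (h : IsPairing d A B)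
    (hint : IntegrableOn w (Metric.closedBall (0 : EuclideanSpace ℝ (Fin 3)) 1) volume)
    (hrad : ∀ p ∈ Metric.closedBall (0 : EuclideanSpace ℝ (Fin 3)) 1, w p = g ‖p‖)
    {s : ℕ} (hs : s ∈ Finset.Icc d (n - d)) :
    (averageState n w).mulVec (vVec d s A B) = (ballEigenvalue n w d : ℂ) • vVec d s A B := by
  have hd := h.two_mul_le
  set c : ℕ → ℂ := fun s => (averageState n w).mulVec (vVec d s A B) (repSet A B s) with hc
  have hdiag : ∀ s ∈ Finset.Icc d (n - d),
      (averageState n w).mulVec (vVec d s A B) = c s • vVec d s A B := by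
    intro s hs
    refine h.mulVec_eq_smul (permInvariant_averageState n w) hs fun T hT => ?_
    rw [Matrix.mulVec, dotProduct]
    refine Finset.sum_eq_zero fun J _ => ?_
    by_cases hJ : J.card = s
    · rw [averageState_eq_zero hint hrad (by omega), zero_mul]
    · rw [h.vVec_eq_zero (Finset.mem_Icc.1 hs).1 hJ, mul_zero]
  have htop : n - d ∈ Finset.Icc d (n - d) := by rw [Finset.mem_Icc]; omega
  have hconst : ∀ s ∈ Finset.Icc d (n - d), c s = c (n - d) := by
    intro s hs
    set f := (tensorPower n hadamardGate).mulVec (vVec d (n - d) A B) with hf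
    have hUU : hadamardGate * hadamardGate.conjTranspose = 1 := by
      rw [hadamardGate_conjTranspose, hadamardGate_mul_self]
    have hcomm := (averageState_commute (n := n) hint hrad hUU (mul_eq_one_comm.1 hUU)).eq
    have h1 : (averageState n w).mulVec f = c (n - d) • f := by
      rw [hf, Matrix.mulVec_mulVec, hcomm, ← Matrix.mulVec_mulVec, hdiag _ htop,
        Matrix.mulVec_smul]
    have h2 : (averageState n w).mulVec f (repSet A B s) = f (repSet A B s) * c s := by
      have hfs := h.eq_sum ((permInvariant_tensorPower n hadamardGate).mulVec_mem_pairSpace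
        (h.vVec_mem (n - d)))
      rw [← hf] at hfs
      conv_lhs => rw [hfs]
      rw [Matrix.mulVec_sum, Finset.sum_apply, Finset.sum_eq_single_of_mem s hs]
      · rw [Matrix.mulVec_smul, hdiag s hs, Pi.smul_apply, Pi.smul_apply, h.vVec_repSet hs hs]
        simp
      · intro t ht hts
        rw [Matrix.mulVec_smul, hdiag t ht, Pi.smul_apply, Pi.smul_apply, h.vVec_repSet ht hs,
          if_neg hts]
        simp
    rw [h1, Pi.smul_apply, smul_eq_mul, mul_comm] at h2
    exact (mul_left_cancel₀ (h.hadamard_ne_zero hs) h2).symm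
  have htrace : ((n : ℂ) - 2 * d + 1) * c (n - d) =
      ((∫ p in Metric.closedBall (0 : EuclideanSpace ℝ (Fin 3)) 1,
        eigenWeight n d ‖p‖ * w p : ℝ) : ℂ) := by
    have h1 : pairTrace d A B (averageState n w) = ((n : ℂ) - 2 * d + 1) * c (n - d) := by
      rw [pairTrace, Finset.sum_congr rfl hconst, Finset.sum_const, Nat.card_Icc, nsmul_eq_mul,
        show n - d + 1 - d = n - 2 * d + 1 by omega]
      push_cast [Nat.cast_sub hd]
      ring
    have h2 := map_averageState (n := n) hint
      { toFun := fun M => pairTrace d A B M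
        map_add' := fun M N => by
          simp [pairTrace, Matrix.add_mulVec, Finset.sum_add_distrib]
        map_smul' := fun c M => by
          simp [pairTrace, Matrix.smul_mulVec, Finset.mul_sum] }
    change pairTrace d A B _ = ∫ p in _, pairTrace d A B _ * _ at h2
    simp only [h.pairTrace_tensorPower_qubit] at h2
    rw [← h1, h2, ← integral_complex_ofReal]
    push_cast
    rfl
  have hne : ((n : ℂ) - 2 * d + 1) ≠ 0 := by
    have : ((n : ℂ) - 2 * d + 1) = ((n - 2 * d + 1 : ℕ) : ℂ) := by
      push_cast [Nat.cast_sub hd]; ring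
    rw [this, Nat.cast_ne_zero]
    omega
  rw [hdiag s hs, hconst s hs, ballEigenvalue]
  congr 1
  rw [Complex.ofReal_mul, ← htrace]
  push_cast
  field_simp

end Average

/-! ### Ballot paths -/

lemma pathHeight_eq {n : ℕ} (p : Fin n → Bool) (k : ℕ) :
    pathHeight p k = (({i | i.val < k ∧ p i = true} : Finset (Fin n)).card : ℤ) -
      (({i | i.val < k ∧ p i = false} : Finset (Fin n)).card : ℤ) := by
  have h : ∀ i : Fin n, (if p i = true then (1 : ℤ) else -1) =
      (if p i = true then 1 else 0) - (if p i = false then 1 else 0) := by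
    intro i; cases p i <;> simp
  rw [pathHeight, Finset.sum_congr rfl fun i _ => h i, Finset.sum_sub_distrib, Finset.sum_boole,
    Finset.sum_boole, Finset.filter_filter, Finset.filter_filter]

namespace BallotPath

variable {n d : ℕ}

lemma two_mul_le (P : BallotPath n d) : 2 * d ≤ n := by
  have := P.nonneg n le_rfl
  rw [P.endpoint] at this
  omega

lemma card_up_add_card_down (P : BallotPath n d) :
    ({i | P.step i = true} : Finset (Fin n)).card + P.downSet.card = n := by
  have := Finset.card_filter_add_card_filter_not (s := Finset.univ) fun i => P.step i = true
  simpa [downSet] using this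

lemma card_downSet (P : BallotPath n d) : P.downSet.card = d := by
  have h := P.endpoint
  rw [pathHeight_eq] at h
  have h2 := P.card_up_add_card_down
  simp only [Fin.is_lt, true_and] at h
  have : (P.downSet.card : ℤ) = ({i | P.step i = false} : Finset (Fin n)).card := rfl
  omega

lemma card_upSet (P : BallotPath n d) : P.upSet.card = d := by
  set S : Finset (Fin n) := {i | P.step i = true} with hS
  set f : Fin n → ℕ := fun i => ({j | j < i ∧ P.step j = true} : Finset (Fin n)).card with hf
  have hlt : ∀ a b, a ∈ S → a < b → f a < f b := by
    intro a b ha hab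
    refine Finset.card_lt_card ⟨fun x hx => ?_, fun h => ?_⟩
    · simp only [Finset.mem_filter, Finset.mem_univ, true_and] at hx ⊢
      exact ⟨hx.1.trans hab, hx.2⟩
    · have := h (Finset.mem_filter.2 ⟨Finset.mem_univ a, hab, by simpa [hS] using ha⟩)
      simp at this
  have hinj : Set.InjOn f S := by
    intro a ha b hb h
    rcases lt_trichotomy a b with hab | hab | hab
    · exact absurd h (hlt a b ha hab).ne
    · exact hab
    · exact absurd h (hlt b a hb hab).ne'
  have himg : S.image f = Finset.range S.card := by
    refine Finset.eq_of_subset_of_card_le (fun k hk => ?_) ?_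
    · obtain ⟨a, ha, rfl⟩ := Finset.mem_image.1 hk
      refine Finset.mem_range.2 (Finset.card_lt_card ⟨fun x hx => ?_, fun h => ?_⟩)
      · simp only [Finset.mem_filter, Finset.mem_univ, true_and, hS] at hx ⊢
        exact hx.2
      · have := h ha
        simp at this
    · rw [Finset.card_image_of_injOn hinj, Finset.card_range]
  have hup : P.upSet = S.filter fun i => f i < d := by
    ext i; simp [upSet, hS, hf]
  have himg' : P.upSet.image f = Finset.range d := by
    ext k
    rw [hup, Finset.mem_image, Finset.mem_range]
    constructor
    · rintro ⟨a, ha, rfl⟩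
      exact (Finset.mem_filter.1 ha).2
    · intro hk
      have h1 : S.card + P.downSet.card = n := P.card_up_add_card_down
      have h2 := P.card_downSet
      have h3 := P.two_mul_le
      have hk' : k ∈ S.image f := by rw [himg, Finset.mem_range]; omega
      obtain ⟨a, ha, rfl⟩ := Finset.mem_image.1 hk'
      exact ⟨a, Finset.mem_filter.2 ⟨ha, hk⟩, rfl⟩
  have hinj' : Set.InjOn f P.upSet :=
    hinj.mono (by rw [hup]; exact Finset.filter_subset _ _)
  rw [← Finset.card_image_of_injOn hinj', himg', Finset.card_range]

lemma isPairing (P : BallotPath n d) : IsPairing d P.upSet P.downSet where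
  disj := by
    rw [Finset.disjoint_left]
    intro i hi hi'
    simp only [upSet, downSet, Finset.mem_filter, Finset.mem_univ, true_and] at hi hi'
    simp [hi.1] at hi'
  cardA := P.card_upSet
  cardB := P.card_downSet

/-- Each down-step comes after the up-step it is matched with: otherwise the path would be below
the axis right after that down-step. -/
lemma lt_of_rankIn_eq (P : BallotPath n d) {a b : Fin n} (ha : a ∈ P.upSet) (hb : b ∈ P.downSet)
    (h : rankIn P.upSet a = rankIn P.downSet b) : a < b := by
  by_contra hab
  have hne : b ≠ a := fun hba => Finset.disjoint_left.1 P.isPairing.disj ha (hba ▸ hb)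
  have hba : b < a := lt_of_le_of_ne (not_lt.1 hab) hne
  have hnn := P.nonneg (b + 1) (by omega)
  rw [pathHeight_eq] at hnn
  -- up-steps up to `b` are elements of `upSet` before `a`
  have h1 : (({i | i.val < b + 1 ∧ P.step i = true} : Finset (Fin n)).card) + 1 +
      rankIn P.upSet a ≤ d := by
    have hsub : (({i | i.val < b + 1 ∧ P.step i = true} : Finset (Fin n)) ⊆
        P.upSet.filter fun i => i < a) := by
      intro i hi
      simp only [Finset.mem_filter, Finset.mem_univ, true_and, upSet] at hi ha ⊢
      have hia : i < a := by rw [Fin.lt_def] at hba ⊢; omega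
      refine ⟨⟨hi.2, lt_of_le_of_lt (Finset.card_le_card fun j hj => ?_) ha.2⟩, hia⟩
      simp only [Finset.mem_filter, Finset.mem_univ, true_and] at hj ⊢
      exact ⟨hj.1.trans hia, hj.2⟩
    have hc := Finset.card_le_card hsub
    have hsplit := Finset.card_filter_add_card_filter_not (s := P.upSet) fun i => i < a
    have hge : (P.upSet.filter fun i => ¬ i < a) = insert a (P.upSet.filter fun i => a < i) := by
      ext i
      simp only [Finset.mem_filter, Finset.mem_insert, not_lt, le_iff_lt_or_eq]
      constructor
      · rintro ⟨h1, h2 | h2⟩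
        · exact Or.inr ⟨h1, h2⟩
        · exact Or.inl h2.symm
      · rintro (rfl | ⟨h1, h2⟩)
        · exact ⟨ha, Or.inr rfl⟩
        · exact ⟨h1, Or.inl h2⟩
    rw [hge, Finset.card_insert_of_notMem (by simp), P.card_upSet] at hsplit
    have : rankIn P.upSet a = (P.upSet.filter fun i => a < i).card := rfl
    omega
  have h2 : (({i | i.val < b + 1 ∧ P.step i = false} : Finset (Fin n)).card) +
      rankIn P.downSet b = d := by
    have hsplit := Finset.card_filter_add_card_filter_not (s := P.downSet) fun i => b < i
    rw [P.card_downSet] at hsplit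
    have hs : (({i | i.val < b + 1 ∧ P.step i = false} : Finset (Fin n)) =
        P.downSet.filter fun i => ¬ b < i) := by
      ext i
      simp only [downSet, Finset.mem_filter, Finset.mem_univ, true_and, not_lt, Fin.le_def]
      rw [Nat.lt_succ_iff, and_comm]
    have : rankIn P.downSet b = (P.downSet.filter fun i => b < i).card := rfl
    rw [hs]
    omega
  omega

lemma step_injective : Function.Injective (step : BallotPath n d → Fin n → Bool) := by
  rintro ⟨p, hp, hp'⟩ ⟨q, hq, hq'⟩ rfl
  rfl

lemma downSet_injective : Function.Injective (downSet : BallotPath n d → Finset (Fin n)) := by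
  intro P Q h
  refine step_injective (funext fun i => ?_)
  have := Finset.ext_iff.1 h i
  simp only [downSet, Finset.mem_filter, Finset.mem_univ, true_and] at this
  cases hP : P.step i <;> cases hQ : Q.step i <;> simp_all

noncomputable instance : Fintype (BallotPath n d) := Fintype.ofInjective _ step_injective

end BallotPath

/-! ### Counting ballot paths -/

lemma pathHeight_snoc_of_le {n : ℕ} (p : Fin n → Bool) (x : Bool) {k : ℕ} (hk : k ≤ n) :
    pathHeight (Fin.snoc p x : Fin (n + 1) → Bool) k = pathHeight p k := by
  rw [pathHeight, pathHeight, Finset.sum_filter, Finset.sum_filter, Fin.sum_univ_castSucc]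
  simp [Nat.not_lt.2 hk]

lemma pathHeight_snoc {n : ℕ} (p : Fin n → Bool) (x : Bool) :
    pathHeight (Fin.snoc p x : Fin (n + 1) → Bool) (n + 1) =
      pathHeight p n + if x = true then 1 else -1 := by
  rw [pathHeight, pathHeight, Finset.sum_filter, Finset.sum_filter, Fin.sum_univ_castSucc]
  simp

lemma card_ballotPath_zero (n : ℕ) : Fintype.card (BallotPath n 0) = 1 := by
  rw [Fintype.card_eq_one_iff]
  refine ⟨⟨fun _ => true, fun k _ => ?_, ?_⟩, fun P => BallotPath.downSet_injective ?_⟩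
  · rw [pathHeight_eq]; simp
  · rw [pathHeight_eq]; simp
  · rw [Finset.card_eq_zero.1 P.card_downSet]
    symm
    simp [BallotPath.downSet]

lemma card_ballotPath_eq_zero {n d : ℕ} (h : n < 2 * d) : Fintype.card (BallotPath n d) = 0 :=
  Fintype.card_eq_zero_iff.2 ⟨fun P => by have := P.two_mul_le; omega⟩

/-- Splitting a ballot path at its last step. -/
lemma card_ballotPath_succ_succ {n d : ℕ} (h : 2 * (d + 1) ≤ n + 1) :
    Fintype.card (BallotPath (n + 1) (d + 1)) =
      Fintype.card (BallotPath n (d + 1)) + Fintype.card (BallotPath n d) := by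
  rw [← Fintype.card_sum]
  symm
  have hmk : ∀ (p : Fin n → Bool) (x : Bool), (∀ k ≤ n, 0 ≤ pathHeight p k) →
      pathHeight p n + (if x = true then 1 else -1) = (n : ℤ) + 1 - 2 * (d + 1) →
      (∀ k ≤ n + 1, 0 ≤ pathHeight (Fin.snoc p x : Fin (n + 1) → Bool) k) ∧
      pathHeight (Fin.snoc p x : Fin (n + 1) → Bool) (n + 1) =
        ((n + 1 : ℕ) : ℤ) - 2 * ((d + 1 : ℕ) : ℤ) := by
    intro p x hp he
    refine ⟨fun k hk => ?_, ?_⟩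
    · rcases Nat.lt_or_ge n k with hnk | hnk
      · obtain rfl : k = n + 1 := by omega
        rw [pathHeight_snoc, he]
        omega
      · rw [pathHeight_snoc_of_le _ _ hnk]
        exact hp k hnk
    · rw [pathHeight_snoc, he]
      push_cast
      ring
  have h1 : ∀ P : BallotPath n (d + 1), pathHeight P.step n + (if true = true then 1 else -1) =
      (n : ℤ) + 1 - 2 * (d + 1) := fun P => by
    rw [P.endpoint]; push_cast; simp; ring
  have h2 : ∀ P : BallotPath n d, pathHeight P.step n + (if false = true then 1 else -1) =
      (n : ℤ) + 1 - 2 * (d + 1) := fun P => by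
    rw [P.endpoint]; simp; ring
  let F : BallotPath n (d + 1) ⊕ BallotPath n d → BallotPath (n + 1) (d + 1) :=
    Sum.elim
      (fun P => ⟨Fin.snoc P.step true, (hmk _ _ P.nonneg (h1 P)).1, (hmk _ _ P.nonneg (h1 P)).2⟩)
      (fun P => ⟨Fin.snoc P.step false, (hmk _ _ P.nonneg (h2 P)).1, (hmk _ _ P.nonneg (h2 P)).2⟩)
  refine Fintype.card_of_bijective (f := F) ⟨?_, ?_⟩
  · have hstep : ∀ {p q : Fin n → Bool} {x y : Bool},
        (Fin.snoc p x : Fin (n + 1) → Bool) = Fin.snoc q y → p = q ∧ x = y := fun h =>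
      Fin.snoc_inj.1 h
    rintro (P | P) (Q | Q) hPQ
    · exact congrArg _ (BallotPath.step_injective (hstep (congrArg BallotPath.step hPQ)).1)
    · exact absurd (hstep (congrArg BallotPath.step hPQ)).2 (by simp)
    · exact absurd (hstep (congrArg BallotPath.step hPQ)).2 (by simp)
    · exact congrArg _ (BallotPath.step_injective (hstep (congrArg BallotPath.step hPQ)).1)
  · intro P
    have hP : P.step = Fin.snoc (Fin.init P.step) (P.step (Fin.last n)) :=
      (Fin.snoc_init_self _).symm
    have hnn : ∀ k ≤ n, 0 ≤ pathHeight (Fin.init P.step : Fin n → Bool) k := fun k hk => by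
      rw [← pathHeight_snoc_of_le (Fin.init P.step : Fin n → Bool) (P.step (Fin.last n)) hk, ← hP]
      exact P.nonneg k (by omega)
    have he := P.endpoint
    rw [hP, pathHeight_snoc] at he
    cases hx : P.step (Fin.last n) with
    | true =>
      rw [hx] at he hP
      refine ⟨Sum.inl ⟨Fin.init P.step, hnn, ?_⟩, BallotPath.step_injective hP.symm⟩
      push_cast at he ⊢
      simp at he
      linarith
    | false =>
      rw [hx] at he hP
      refine ⟨Sum.inr ⟨Fin.init P.step, hnn, ?_⟩, BallotPath.step_injective hP.symm⟩
      push_cast at he ⊢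
      linarith

lemma card_ballotPath_add_choose {n d : ℕ} (h : 2 * (d + 1) ≤ n + 1) :
    Fintype.card (BallotPath n (d + 1)) + n.choose d = n.choose (d + 1) := by
  induction n generalizing d with
  | zero => omega
  | succ n ih =>
    rcases Nat.lt_or_ge (n + 1) (2 * (d + 1)) with hlt | hle
    · obtain rfl : n = 2 * d := by omega
      rw [card_ballotPath_eq_zero hlt, zero_add, ← Nat.choose_symm_half]
    · rw [card_ballotPath_succ_succ hle, Nat.choose_succ_succ n d]
      have h1 := ih hle
      cases d with
      | zero =>
        rw [card_ballotPath_zero]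
        simp at h1 ⊢
        omega
      | succ d =>
        have h2 := ih (d := d) (by omega)
        rw [Nat.choose_succ_succ n d]
        simp only [Nat.succ_eq_add_one]
        omega

lemma card_ballotPath {n d : ℕ} (h : 2 * d ≤ n) :
    (Fintype.card (BallotPath n d) : ℝ) =
      ((n : ℝ) - 2 * d + 1) / (n + 1) * ((n + 1).choose d : ℝ) := by
  cases d with
  | zero =>
    rw [card_ballotPath_zero]
    have : (n : ℝ) + 1 ≠ 0 := by positivity
    simp [this]
  | succ d =>
    have h1 : (Fintype.card (BallotPath n (d + 1)) : ℝ) + n.choose d = n.choose (d + 1) := by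
      exact_mod_cast card_ballotPath_add_choose (by omega)
    have h2 : ((n : ℝ) + 1) * n.choose d = (n + 1).choose (d + 1) * ((d : ℝ) + 1) := by
      exact_mod_cast Nat.add_one_mul_choose_eq n d
    have h3 : ((n + 1).choose (d + 1) : ℝ) = n.choose d + n.choose (d + 1) := by
      exact_mod_cast Nat.choose_succ_succ n d
    have : (n : ℝ) + 1 ≠ 0 := by positivity
    field_simp
    push_cast
    linear_combination ((n : ℝ) + 1) * h1 - (n + 1) * h3 - 2 * h2

lemma sum_range_card_ballotPath (n : ℕ) :
    ∑ d ∈ Finset.range (n + 1), (n + 1 - 2 * d) * Fintype.card (BallotPath n d) = 2 ^ n := by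
  induction n with
  | zero => simp [card_ballotPath_zero]
  | succ n ih =>
    have hrec : ∀ d ∈ Finset.range (n + 1),
        (n + 1 + 1 - 2 * (d + 1)) * Fintype.card (BallotPath (n + 1) (d + 1)) =
          (n + 2 - 2 * (d + 1)) * Fintype.card (BallotPath n (d + 1)) +
          (n - 2 * d) * Fintype.card (BallotPath n d) := by
      intro d _
      rcases Nat.lt_or_ge (n + 1) (2 * (d + 1)) with hlt | hle
      · rw [show n + 1 + 1 - 2 * (d + 1) = 0 by omega,
          show n - 2 * d = 0 by omega]
        simp
      · rw [card_ballotPath_succ_succ hle, mul_add,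
          show n + 1 + 1 - 2 * (d + 1) = n - 2 * d by omega]
    have hshift : ∑ d ∈ Finset.range (n + 1),
        (n + 2 - 2 * (d + 1)) * Fintype.card (BallotPath n (d + 1)) + (n + 2) =
        ∑ d ∈ Finset.range (n + 1), (n + 2 - 2 * d) * Fintype.card (BallotPath n d) := by
      have h := Finset.sum_range_succ' (fun d =>
        (n + 2 - 2 * d) * Fintype.card (BallotPath n d)) (n + 1)
      rw [Finset.sum_range_succ, card_ballotPath_eq_zero (show n < 2 * (n + 1) by omega)] at h
      simp only [mul_zero, add_zero, card_ballotPath_zero, mul_one, Nat.sub_zero] at h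
      exact h.symm
    rw [Finset.sum_range_succ', Finset.sum_congr rfl hrec, Finset.sum_add_distrib,
      card_ballotPath_zero, pow_succ, ← ih, Finset.sum_mul, add_right_comm]
    rw [show (n + 1 + 1 - 2 * 0) * 1 = n + 2 by omega, hshift, ← Finset.sum_add_distrib]
    refine Finset.sum_congr rfl fun d _ => ?_
    rcases Nat.lt_or_ge n (2 * d) with hlt | hle
    · simp [card_ballotPath_eq_zero hlt]
    · rw [← add_mul, show n + 2 - 2 * d + (n - 2 * d) = (n + 1 - 2 * d) * 2 by omega]
      ring

lemma sum_card_ballotPath (n : ℕ) :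
    ∑ d ∈ Finset.range (n / 2 + 1), (n - d + 1 - d) * Fintype.card (BallotPath n d) = 2 ^ n := by
  rw [← sum_range_card_ballotPath n]
  have hsub : Finset.range (n / 2 + 1) ⊆ Finset.range (n + 1) := by
    intro d hd; rw [Finset.mem_range] at hd ⊢; omega
  rw [← Finset.sum_subset hsub]
  · refine Finset.sum_congr rfl fun d hd => ?_
    rw [Finset.mem_range] at hd
    rw [show n - d + 1 - d = n + 1 - 2 * d by omega]
  · intro d _ hd
    rw [Finset.mem_range] at hd
    rw [card_ballotPath_eq_zero (by omega), mul_zero]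

/-! ### Linear independence of the vectors of the ballot paths -/

/-- The matrix that maps a vector `f` to the vector whose coordinate at a set `S` of size `d` is the
sum of the coordinates of `f` at the supersets of `S` of size `s`, and whose other coordinates
vanish. -/
noncomputable def supersetSum (n s d : ℕ) : Matrix (Finset (Fin n)) (Finset (Fin n)) ℂ :=
  Matrix.of fun S T => if S ⊆ T ∧ T.card = s ∧ S.card = d then 1 else 0

lemma permInvariant_supersetSum (n s d : ℕ) : PermInvariant (supersetSum n s d) := by
  intro π I J
  simp [supersetSum]

section Pairing

variable {n d : ℕ} {A B : Finset (Fin n)}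

/-- `supersetSum` lowers `v_{d,s}(A,B)` to a nonzero multiple of `v_{d,d}(A,B)`. -/
lemma IsPairing.supersetSum_mulVec (h : IsPairing d A B) {s : ℕ}
    (hs : s ∈ Finset.Icc d (n - d)) :
    ∃ κ : ℂ, κ ≠ 0 ∧ (supersetSum n s d).mulVec (vVec d s A B) = κ • vVec d d A B := by
  classical
  have hd : d ∈ Finset.Icc d (n - d) := by
    have := h.two_mul_le
    rw [Finset.mem_Icc]; omega
  refine ⟨_, ?_, h.mulVec_eq_smul (permInvariant_supersetSum n s d) hd fun T hT => ?_⟩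
  · have hR : repSet A B d = B := by
      obtain ⟨h1, -, h3⟩ := h.repSet_spec hd
      exact (Finset.eq_of_subset_of_card_le h1 (by rw [h3, h.cardB])).symm
    have hterm : ∀ T, supersetSum n s d B T * vVec d s A B T =
        if B ⊆ T ∧ vVec d s A B T ≠ 0 then 1 else 0 := by
      intro T
      by_cases hBT : B ⊆ T
      swap; · simp [supersetSum, hBT]
      by_cases hv : vVec d s A B T = 0
      · simp [hv]
      have hc := card_of_vVec_ne_zero h.disj h.cardA h.cardB (Finset.mem_Icc.1 hs).1 hv
      have htr : IsTransversal A B T ∧ (T \ (A ∪ B)).card = s - d := by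
        by_contra hT
        exact hv (by rw [vVec_apply d s h.disj h.card_eq, if_neg hT])
      have hTA : T ∩ A = ∅ := by
        rw [← Finset.disjoint_iff_inter_eq_empty, Finset.disjoint_right]
        intro a ha haT
        obtain ⟨b, hb, hr⟩ := h.exists_right ha
        exact (htr.1 a ha b hb hr).1 haT (hBT hb)
      rw [if_pos ⟨hBT, hv⟩, vVec_apply d s h.disj h.card_eq, if_pos htr, hTA]
      simp [supersetSum, hBT, hc, h.cardB]
    rw [hR, Matrix.mulVec, dotProduct, Finset.sum_congr rfl fun T _ => hterm T, Finset.sum_boole,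
      Nat.cast_ne_zero, Finset.card_ne_zero]
    refine ⟨repSet A B s, ?_⟩
    rw [Finset.mem_filter_univ, h.vVec_repSet hs hs]
    exact ⟨(h.repSet_spec hs).1, by simp⟩
  · rw [Matrix.mulVec, dotProduct]
    refine Finset.sum_eq_zero fun J _ => ?_
    simp [supersetSum, hT]

/-- If each element of `A` precedes its match in `B`, then `B` has the largest sum among the sets of
the support of `v_{d,d}(A,B)`. -/
lemma IsPairing.sum_add_card_le (h : IsPairing d A B)
    (hlt : ∀ a ∈ A, ∀ b ∈ B, rankIn A a = rankIn B b → a < b) {T : Finset (Fin n)}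
    (hT : IsTransversal A B T) (hsub : T ⊆ A ∪ B) :
    ∑ x ∈ T, (x : ℕ) + (T ∩ A).card ≤ ∑ x ∈ B, (x : ℕ) := by
  induction hk : (T ∩ A).card generalizing T with
  | zero =>
    have := eq_union_sdiff h hT (Finset.card_eq_zero.1 hk)
    rw [Finset.sdiff_eq_empty_iff_subset.2 hsub, Finset.union_empty] at this
    rw [this, add_zero]
  | succ k ih =>
    obtain ⟨a, ha⟩ := Finset.card_pos (s := T ∩ A).1 (by omega)
    obtain ⟨haT, ha⟩ := Finset.mem_inter.1 ha
    obtain ⟨b, hb, hr⟩ := h.exists_right ha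
    have hbT := (hT a ha b hb hr).1 haT
    have hab := hlt a ha b hb hr
    have hc := card_inter_map_swap h.disj ha hb haT hbT
    have hsub' : T.map (Equiv.swap a b).toEmbedding ⊆ A ∪ B := by
      rw [← Finset.sdiff_eq_empty_iff_subset, map_swap_sdiff ha hb,
        Finset.sdiff_eq_empty_iff_subset]
      exact hsub
    have h1 := ih ((isTransversal_map_swap h.disj ha hb hr T).2 hT) hsub' (by omega)
    have h2 : ∑ x ∈ T, (x : ℕ) < ∑ x ∈ T, (Equiv.swap a b x : ℕ) := by
      refine Finset.sum_lt_sum (fun x hx => ?_) ⟨a, haT, ?_⟩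
      · by_cases hxa : x = a
        · subst hxa; rw [Equiv.swap_apply_left]; exact hab.le
        · rw [Equiv.swap_apply_of_ne_of_ne hxa]
          rintro rfl
          exact hbT hx
      · rw [Equiv.swap_apply_left]; exact hab
    rw [Finset.sum_map] at h1
    simp only [Equiv.coe_toEmbedding] at h1
    omega

end Pairing

section Ballot

variable {n d : ℕ}

lemma BallotPath.eq_or_sum_lt (P : BallotPath n d) {T : Finset (Fin n)}
    (hT : vVec d d P.upSet P.downSet T ≠ 0) :
    T = P.downSet ∨ ∑ x ∈ T, (x : ℕ) < ∑ x ∈ P.downSet, (x : ℕ) := by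
  have h := P.isPairing
  have htr : IsTransversal P.upSet P.downSet T ∧
      (T \ (P.upSet ∪ P.downSet)).card = d - d := by
    by_contra htr
    exact hT (by rw [vVec_apply d d h.disj h.card_eq, if_neg htr])
  obtain ⟨htr, hc⟩ := htr
  rw [Nat.sub_self, Finset.card_eq_zero] at hc
  rcases Nat.eq_zero_or_pos (T ∩ P.upSet).card with h0 | hpos
  · left
    have := eq_union_sdiff h htr (Finset.card_eq_zero.1 h0)
    rwa [hc, Finset.union_empty] at this
  · right
    have := h.sum_add_card_le (fun a ha b hb hr => P.lt_of_rankIn_eq ha hb hr) htr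
      (Finset.sdiff_eq_empty_iff_subset.1 hc)
    omega

lemma BallotPath.vVec_downSet (P : BallotPath n d) :
    vVec d d P.upSet P.downSet P.downSet = 1 := by
  have h := P.isPairing
  have hd : d ∈ Finset.Icc d (n - d) := by
    have := h.two_mul_le
    rw [Finset.mem_Icc]; omega
  have h2 := h.vVec_repSet hd hd
  obtain ⟨h1, -, h3⟩ := h.repSet_spec hd
  rwa [← Finset.eq_of_subset_of_card_le h1 (by rw [h3, h.cardB]), if_pos rfl] at h2

/-- For `s = d` the vectors are triangular with respect to the sum of the down-step positions. -/
lemma linearIndependent_vVec_self (n d : ℕ) :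
    LinearIndependent ℂ fun P : BallotPath n d => vVec d d P.upSet P.downSet := by
  classical
  rw [Fintype.linearIndependent_iff]
  intro c hc
  by_contra! hne
  obtain ⟨P₀, hP₀⟩ := hne
  obtain ⟨P, hP, hmax⟩ := Finset.exists_max_image
    (Finset.univ.filter fun P : BallotPath n d => c P ≠ 0)
    (fun P => ∑ x ∈ P.downSet, (x : ℕ)) ⟨P₀, by simpa using hP₀⟩
  have h := congrFun hc P.downSet
  rw [Finset.sum_apply, Finset.sum_eq_single P] at h
  · rw [Pi.smul_apply, P.vVec_downSet, smul_eq_mul, mul_one] at h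
    exact (Finset.mem_filter.1 hP).2 h
  · intro Q _ hQP
    rw [Pi.smul_apply, smul_eq_mul]
    by_contra h0
    rw [mul_eq_zero, not_or] at h0
    rcases Q.eq_or_sum_lt h0.2 with heq | hlt
    · exact hQP (BallotPath.downSet_injective heq.symm)
    · exact absurd (hmax Q (by simpa using h0.1)) (not_le.2 hlt)
  · simp

theorem linearIndependent_ballotVec (n d : ℕ) : LinearIndependent ℂ (ballotVec n d) := by
  classical
  rw [Fintype.linearIndependent_iff]
  intro c hc
  rintro ⟨⟨s, hs⟩, P⟩
  -- the part of the relation supported on the subsets of size `s`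
  have h1 : ∑ P : BallotPath n d, c (⟨s, hs⟩, P) • vVec d s P.upSet P.downSet = 0 := by
    ext T
    by_cases hT : T.card = s
    · have h := congrFun hc T
      rw [Fintype.sum_prod_type, Finset.sum_apply, Finset.sum_eq_single ⟨s, hs⟩] at h
      · exact h
      · rintro ⟨t, ht⟩ _ hts
        rw [Finset.sum_apply]
        refine Finset.sum_eq_zero fun Q _ => ?_
        have : vVec d t Q.upSet Q.downSet T = 0 :=
          Q.isPairing.vVec_eq_zero (Finset.mem_Icc.1 ht).1 fun h =>
            hts (Subtype.ext (h.symm.trans hT))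
        simp [ballotVec, this]
      · simp
    · rw [Finset.sum_apply]
      refine Finset.sum_eq_zero fun Q _ => ?_
      simp [Q.isPairing.vVec_eq_zero (Finset.mem_Icc.1 hs).1 hT]
  have h2 := congrArg (supersetSum n s d).mulVec h1
  choose κ hκ hκ' using fun Q : BallotPath n d => Q.isPairing.supersetSum_mulVec hs
  simp only [Matrix.mulVec_sum, Matrix.mulVec_smul, hκ', smul_smul, Matrix.mulVec_zero] at h2
  have h3 := (Fintype.linearIndependent_iff.1 (linearIndependent_vVec_self n d)) _ h2 P
  exact (mul_eq_zero.1 h3).resolve_right (hκ P)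

lemma card_ballotVec_index (n d : ℕ) :
    Fintype.card (↥(Finset.Icc d (n - d)) × BallotPath n d) =
      (n - d + 1 - d) * Fintype.card (BallotPath n d) := by
  rw [Fintype.card_prod, Fintype.card_coe, Nat.card_Icc]

/-- The index set of all the vectors `v_{d,s}(P)`. -/
abbrev BallotIndex (n : ℕ) : Type :=
  Σ d : Fin (n / 2 + 1), ↥(Finset.Icc (d : ℕ) (n - d)) × BallotPath n d

lemma card_ballotIndex (n : ℕ) : Fintype.card (BallotIndex n) = 2 ^ n := by
  rw [Fintype.card_sigma, ← sum_card_ballotPath n, Finset.sum_range]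
  exact Finset.sum_congr rfl fun d _ => card_ballotVec_index n d

/-- Eigenvectors for distinct eigenvalues, linearly independent for each of them, are linearly
independent. -/
lemma linearIndependent_sigma_of_eigenvalues {ι V : Type*} {κ : ι → Type*} [Fintype ι]
    [∀ i, Fintype (κ i)] [AddCommGroup V] [Module ℂ V] (L : Module.End ℂ V) {μ : ι → ℂ}
    (hμ : Function.Injective μ) {v : ∀ i, κ i → V} (hv : ∀ i k, L (v i k) = μ i • v i k)
    (hli : ∀ i, LinearIndependent ℂ (v i)) :
    LinearIndependent ℂ fun x : Σ i, κ i => v x.1 x.2 := by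
  classical
  rw [Fintype.linearIndependent_iff]
  intro c hc
  rw [Fintype.sum_sigma] at hc
  rintro ⟨i, k⟩
  have hmem : ∀ i, ∑ k, c ⟨i, k⟩ • v i k ∈ L.eigenspace (μ i) := fun i =>
    Submodule.sum_mem _ fun k _ => Submodule.smul_mem _ _ (Module.End.mem_eigenspace_iff.2 (hv i k))
  have hzero := (iSupIndep_iff_finsetSum_eq_zero_imp_eq_zero _).1
    (L.eigenspaces_iSupIndep.comp hμ) Finset.univ (fun i => ∑ k, c ⟨i, k⟩ • v i k)
    (fun i _ => hmem i) hc i (Finset.mem_univ i)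
  exact Fintype.linearIndependent_iff.1 (hli i) _ hzero k

end Ballot

/-! ### Positivity and monotonicity of the eigenvalues -/

lemma eigenWeight_pos {n d : ℕ} (hd : 2 * d ≤ n) {r : ℝ} (h0 : 0 < r) (h1 : r < 1) :
    0 < eigenWeight n d r := by
  refine Finset.sum_pos (fun s _ => ?_) ⟨d, by rw [Finset.mem_Icc]; omega⟩
  have : 0 < (1 + r) / 2 := by linarith
  have : 0 < (1 - r) / 2 := by linarith
  positivity

lemma continuous_eigenWeight (n d : ℕ) : Continuous (eigenWeight n d) := by
  unfold eigenWeight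
  fun_prop

/-- The mean of `a^s b^(n-s)` over `d < s < n - d` is smaller than the mean of the two end terms
`s = d` and `s = n - d`. -/
lemma eigenWeight_succ_lt {n d : ℕ} (hd : 2 * (d + 1) ≤ n) {r : ℝ} (h0 : 0 < r) (h1 : r < 1) :
    ((n : ℝ) - 2 * d + 1) * eigenWeight n (d + 1) r <
      ((n : ℝ) - 2 * (d + 1 : ℕ) + 1) * eigenWeight n d r := by
  set a := (1 + r) / 2 with ha
  set b := (1 - r) / 2 with hb
  have hb0 : 0 < b := by rw [hb]; linarith
  have hab : b < a := by rw [ha, hb]; linarith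
  set E := a ^ d * b ^ (n - d) + a ^ (n - d) * b ^ d with hE
  have hsplit : eigenWeight n d r = eigenWeight n (d + 1) r + E := by
    have hset : Finset.Icc d (n - d) =
        insert d (insert (n - d) (Finset.Icc (d + 1) (n - (d + 1)))) := by
      ext s
      simp only [Finset.mem_insert, Finset.mem_Icc]
      omega
    rw [eigenWeight, hset, Finset.sum_insert, Finset.sum_insert, eigenWeight, hE,
      show n - (n - d) = d by omega]
    · ring
    · simp only [Finset.mem_Icc]; omega
    · simp only [Finset.mem_insert, Finset.mem_Icc]; omega
  have hdouble : 2 * eigenWeight n (d + 1) r =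
      ∑ s ∈ Finset.Icc (d + 1) (n - (d + 1)), (a ^ s * b ^ (n - s) + a ^ (n - s) * b ^ s) := by
    have h := eigenWeight_neg (n := n) (d := d + 1) hd r
    rw [Finset.sum_add_distrib, two_mul]
    congr 1
    rw [← h, eigenWeight]
    refine Finset.sum_congr rfl fun s _ => ?_
    rw [sub_neg_eq_add, ← sub_eq_add_neg, mul_comm]
  have hterm : ∀ s ∈ Finset.Icc (d + 1) (n - (d + 1)),
      a ^ s * b ^ (n - s) + a ^ (n - s) * b ^ s < E := by
    intro s hs
    rw [Finset.mem_Icc] at hs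
    obtain ⟨j, rfl⟩ : ∃ j, s = d + j := ⟨s - d, by omega⟩
    obtain ⟨k, rfl⟩ : ∃ k, n = d + j + k + d := ⟨n - d - j - d, by omega⟩
    rw [hE, show d + j + k + d - (d + j) = k + d by omega,
      show d + j + k + d - d = d + j + k by omega]
    have hj : b ^ j < a ^ j := pow_lt_pow_left₀ hab hb0.le (by omega)
    have hk : b ^ k < a ^ k := pow_lt_pow_left₀ hab hb0.le (by omega)
    have hp : 0 < a ^ d * b ^ d := by positivity
    have := mul_pos hp (mul_pos (sub_pos.2 hj) (sub_pos.2 hk))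
    simp only [pow_add]
    nlinarith
  have hlt : 2 * eigenWeight n (d + 1) r < ((n : ℝ) - 2 * (d + 1 : ℕ) + 1) * E := by
    have hc : ((n : ℝ) - 2 * (d + 1 : ℕ) + 1) =
        ((Finset.Icc (d + 1) (n - (d + 1))).card : ℝ) := by
      rw [Nat.card_Icc, show n - (d + 1) + 1 - (d + 1) = n - 2 * (d + 1) + 1 by omega]
      push_cast [Nat.cast_sub hd]
      ring
    rw [hdouble, hc, ← nsmul_eq_mul, ← Finset.sum_const]
    exact Finset.sum_lt_sum_of_nonempty ⟨d + 1, by rw [Finset.mem_Icc]; omega⟩ hterm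
  rw [hsplit]
  push_cast at hlt ⊢
  linarith

section Ball

variable {n : ℕ} {w : EuclideanSpace ℝ (Fin 3) → ℝ} {g : ℝ → ℝ}

lemma integral_mul_pos
    (hnn : ∀ p ∈ Metric.closedBall (0 : EuclideanSpace ℝ (Fin 3)) 1, 0 ≤ w p)
    (hint : IntegrableOn w (Metric.closedBall (0 : EuclideanSpace ℝ (Fin 3)) 1) volume)
    (hone : ∫ p in Metric.closedBall (0 : EuclideanSpace ℝ (Fin 3)) 1, w p = 1)
    {φ : ℝ → ℝ} (hφ : Continuous φ) (hpos : ∀ r, 0 < r → r < 1 → 0 < φ r) :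
    0 < ∫ p in Metric.closedBall (0 : EuclideanSpace ℝ (Fin 3)) 1, φ ‖p‖ * w p := by
  set μ := volume.restrict (Metric.closedBall (0 : EuclideanSpace ℝ (Fin 3)) 1) with hμ
  have hball : ∀ᵐ p ∂μ, p ∈ Metric.closedBall (0 : EuclideanSpace ℝ (Fin 3)) 1 :=
    ae_restrict_mem measurableSet_closedBall
  have hφpos : ∀ᵐ p ∂μ, 0 < φ ‖p‖ := by
    have h0 : ∀ᵐ p ∂μ, p ∉ ({0} : Set (EuclideanSpace ℝ (Fin 3))) :=
      ae_restrict_of_ae (measure_eq_zero_iff_ae_notMem.1 (measure_singleton _))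
    have h1 : ∀ᵐ p ∂μ, p ∉ Metric.sphere (0 : EuclideanSpace ℝ (Fin 3)) 1 :=
      ae_restrict_of_ae (measure_eq_zero_iff_ae_notMem.1 (Measure.addHaar_sphere _ _ _))
    filter_upwards [hball, h0, h1] with p hp hp0 hp1
    refine hpos _ (norm_pos_iff.2 hp0) (lt_of_le_of_ne (by simpa using hp) ?_)
    simpa using hp1
  have hwnn : ∀ᵐ p ∂μ, 0 ≤ w p := by
    filter_upwards [hball] with p hp using hnn p hp
  have hprod : 0 ≤ᵐ[μ] fun p => φ ‖p‖ * w p := by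
    filter_upwards [hφpos, hwnn] with p h1 h2 using mul_nonneg h1.le h2
  have hpint : Integrable (fun p => φ ‖p‖ * w p) μ :=
    IntegrableOn.continuousOn_mul (hφ.comp continuous_norm).continuousOn hint
      (isCompact_closedBall _ _)
  refine lt_of_le_of_ne (integral_nonneg_of_ae hprod) fun h => ?_
  have hz := (integral_eq_zero_iff_of_nonneg_ae hprod hpint).1 h.symm
  have hw0 : w =ᵐ[μ] 0 := by
    filter_upwards [hz, hφpos] with p h1 h2
    exact (mul_eq_zero.1 h1).resolve_left h2.ne'
  rw [integral_congr_ae hw0] at hone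
  simp at hone

lemma cast_sub_two_mul_add_one_pos {n d : ℕ} (hd : 2 * d ≤ n) : 0 < (n : ℝ) - 2 * d + 1 := by
  have : (2 * d : ℝ) ≤ n := by exact_mod_cast hd
  linarith

lemma ballEigenvalue_pos
    (hnn : ∀ p ∈ Metric.closedBall (0 : EuclideanSpace ℝ (Fin 3)) 1, 0 ≤ w p)
    (hint : IntegrableOn w (Metric.closedBall (0 : EuclideanSpace ℝ (Fin 3)) 1) volume)
    (hone : ∫ p in Metric.closedBall (0 : EuclideanSpace ℝ (Fin 3)) 1, w p = 1)
    {d : ℕ} (hd : 2 * d ≤ n) : 0 < ballEigenvalue n w d :=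
  mul_pos (inv_pos.2 (cast_sub_two_mul_add_one_pos hd))
    (integral_mul_pos hnn hint hone (continuous_eigenWeight n d) fun _ h0 h1 => eigenWeight_pos hd h0 h1)

lemma ballEigenvalue_succ_lt
    (hnn : ∀ p ∈ Metric.closedBall (0 : EuclideanSpace ℝ (Fin 3)) 1, 0 ≤ w p)
    (hint : IntegrableOn w (Metric.closedBall (0 : EuclideanSpace ℝ (Fin 3)) 1) volume)
    (hone : ∫ p in Metric.closedBall (0 : EuclideanSpace ℝ (Fin 3)) 1, w p = 1)
    {d : ℕ} (hd : 2 * (d + 1) ≤ n) : ballEigenvalue n w (d + 1) < ballEigenvalue n w d := by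
  have hpint : ∀ φ : ℝ → ℝ, Continuous φ → IntegrableOn (fun p => φ ‖p‖ * w p)
      (Metric.closedBall (0 : EuclideanSpace ℝ (Fin 3)) 1) volume := fun φ hφ =>
    IntegrableOn.continuousOn_mul (hφ.comp continuous_norm).continuousOn hint
      (isCompact_closedBall _ _)
  have h := integral_mul_pos hnn hint hone
    (φ := fun r => ((n : ℝ) - 2 * (d + 1 : ℕ) + 1) * eigenWeight n d r -
      ((n : ℝ) - 2 * d + 1) * eigenWeight n (d + 1) r)
    (by have := continuous_eigenWeight n d; have := continuous_eigenWeight n (d + 1); fun_prop)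
    (fun r h0 h1 => sub_pos.2 (eigenWeight_succ_lt hd h0 h1))
  simp only [sub_mul, mul_assoc] at h
  rw [integral_sub ((hpint _ (continuous_eigenWeight n d)).const_mul _)
    ((hpint _ (continuous_eigenWeight n (d + 1))).const_mul _), integral_const_mul,
    integral_const_mul, sub_pos] at h
  have p1 := cast_sub_two_mul_add_one_pos (n := n) (d := d) (by omega)
  have p2 := cast_sub_two_mul_add_one_pos (n := n) (d := d + 1) hd
  rw [ballEigenvalue, ballEigenvalue, inv_mul_eq_div, inv_mul_eq_div,
    div_lt_div_iff₀ p2 p1]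
  linarith

lemma ballEigenvalue_injOn
    (hnn : ∀ p ∈ Metric.closedBall (0 : EuclideanSpace ℝ (Fin 3)) 1, 0 ≤ w p)
    (hint : IntegrableOn w (Metric.closedBall (0 : EuclideanSpace ℝ (Fin 3)) 1) volume)
    (hone : ∫ p in Metric.closedBall (0 : EuclideanSpace ℝ (Fin 3)) 1, w p = 1) :
    Set.InjOn (ballEigenvalue n w) {d | 2 * d ≤ n} := by
  have hlt : ∀ d e, d < e → 2 * e ≤ n → ballEigenvalue n w e < ballEigenvalue n w d := by
    intro d e hde
    induction e, hde using Nat.le_induction with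
    | base => exact fun he => ballEigenvalue_succ_lt hnn hint hone he
    | succ e hde ih =>
      exact fun he => (ballEigenvalue_succ_lt hnn hint hone he).trans (ih (by omega))
  intro d hd e he h
  rcases lt_trichotomy d e with hde | hde | hde
  · exact absurd h (hlt d e hde he).ne'
  · exact hde
  · exact absurd h (hlt e d hde hd).ne

/-! ### The radial formula for the eigenvalues -/

/-- The geometric series that turns `eigenWeight` into the polynomial of the eigenvalue formula. -/
lemma mul_eigenWeight {n d : ℕ} (hd : 2 * d ≤ n) (r : ℝ) :
    2 ^ (n + 1) * r * eigenWeight n d r =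
      (1 + r) ^ (n - d + 1) * (1 - r) ^ d - (1 + r) ^ d * (1 - r) ^ (n - d + 1) := by
  obtain ⟨m, rfl⟩ : ∃ m, n = 2 * d + m := ⟨n - 2 * d, by omega⟩
  obtain ⟨a, ha⟩ : ∃ a, (1 + r) / 2 = a := ⟨_, rfl⟩
  obtain ⟨b, hb⟩ : ∃ b, (1 - r) / 2 = b := ⟨_, rfl⟩
  have h1 : eigenWeight (2 * d + m) d r =
      a ^ d * b ^ d * ∑ j ∈ Finset.range (m + 1), a ^ j * b ^ (m + 1 - 1 - j) := by
    rw [eigenWeight, ha, hb, ← Finset.Ico_succ_right_eq_Icc, Finset.sum_Ico_eq_sum_range,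
      Finset.mul_sum]
    refine Finset.sum_congr (by congr 1; simp; omega) fun j hj => ?_
    rw [Finset.mem_range] at hj
    rw [show 2 * d + m - (d + j) = d + (m + 1 - 1 - j) by omega, pow_add, pow_add]
    ring
  have h2 := (Commute.all a b).geom_sum₂_mul (m + 1)
  have hr : a - b = r := by linarith
  rw [hr] at h2
  have h3 : 1 + r = 2 * a := by linarith
  have h4 : 1 - r = 2 * b := by linarith
  rw [h1, h3, h4, show 2 * d + m - d + 1 = d + (m + 1) by omega]
  linear_combination 2 ^ (2 * d + m + 1) * a ^ d * b ^ d * h2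

lemma integral_ball_eq_radial (φ : ℝ → ℝ) :
    ∫ p in Metric.closedBall (0 : EuclideanSpace ℝ (Fin 3)) 1, φ ‖p‖ =
      4 * Real.pi * ∫ r in (0 : ℝ)..1, r ^ 2 * φ r := by
  have h := integral_fun_norm_addHaar (volume : Measure (EuclideanSpace ℝ (Fin 3)))
    ((Set.Iic 1).indicator φ)
  have hleft : ∫ p : EuclideanSpace ℝ (Fin 3), (Set.Iic 1).indicator φ ‖p‖ =
      ∫ p in Metric.closedBall (0 : EuclideanSpace ℝ (Fin 3)) 1, φ ‖p‖ := by
    rw [← integral_indicator measurableSet_closedBall]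
    congr 1
    ext p
    simp [Set.indicator]
  have hright : ∫ y in Set.Ioi (0 : ℝ), y ^ (3 - 1) • (Set.Iic 1).indicator φ y =
      ∫ r in (0 : ℝ)..1, r ^ 2 * φ r := by
    rw [intervalIntegral.integral_of_le zero_le_one, ← integral_indicator measurableSet_Ioi,
      ← integral_indicator measurableSet_Ioc]
    congr 1
    ext y
    by_cases h0 : 0 < y <;> by_cases h1 : y ≤ 1 <;> simp [Set.indicator, h0, h1]
  have hdim : Module.finrank ℝ (EuclideanSpace ℝ (Fin 3)) = 3 := by simp
  have hvol : (volume : Measure (EuclideanSpace ℝ (Fin 3))).real (Metric.ball 0 1) =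
      Real.pi * 4 / 3 := by
    rw [Measure.real, EuclideanSpace.volume_ball_fin_three]
    simp
    positivity
  rw [hleft, hdim, hright, hvol] at h
  rw [h]
  simp only [nsmul_eq_mul, smul_eq_mul]
  push_cast
  ring

lemma intervalIntegrable_radial
    (hint : IntegrableOn w (Metric.closedBall (0 : EuclideanSpace ℝ (Fin 3)) 1) volume)
    (hrad : ∀ p ∈ Metric.closedBall (0 : EuclideanSpace ℝ (Fin 3)) 1, w p = g ‖p‖) :
    IntervalIntegrable (fun r => r ^ 2 * g r) volume 0 1 := by
  have h1 : IntegrableOn (fun p : EuclideanSpace ℝ (Fin 3) => g ‖p‖) (Metric.ball 0 1) volume :=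
    IntegrableOn.congr_fun (hint.mono_set Metric.ball_subset_closedBall)
      (fun p hp => hrad p (Metric.ball_subset_closedBall hp)) measurableSet_ball
  rw [integrableOn_fun_norm_addHaar] at h1
  rw [intervalIntegrable_iff_integrableOn_Ioo_of_le zero_le_one]
  simpa using h1

lemma ballEigenvalue_eq_radial
    (hrad : ∀ p ∈ Metric.closedBall (0 : EuclideanSpace ℝ (Fin 3)) 1, w p = g ‖p‖)
    {d : ℕ} : ballEigenvalue n w d =
      eigenFactor n d * ∫ r in (0 : ℝ)..1, 2 ^ (n + 1) * (r ^ 2 * g r) * eigenWeight n d r := by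
  rw [ballEigenvalue, setIntegral_congr_fun (g := fun p => eigenWeight n d ‖p‖ * g ‖p‖)
    measurableSet_closedBall (fun p hp => by simp only [hrad p hp]),
    integral_ball_eq_radial fun r => eigenWeight n d r * g r]
  have h : ∀ r : ℝ, 2 ^ (n + 1) * (r ^ 2 * g r) * eigenWeight n d r =
      2 ^ (n + 1) * (r ^ 2 * (eigenWeight n d r * g r)) := fun r => by ring
  simp only [h]
  rw [intervalIntegral.integral_const_mul, eigenFactor,
    zpow_sub₀ two_ne_zero, zpow_natCast, zpow_one, pow_succ]
  rw [div_mul_eq_mul_div, inv_mul_eq_div]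
  field_simp
  ring

/-- The singular parts of the integrand at `r` and `-r` cancel. -/
lemma eigenIntegrand_add_neg {d : ℕ} (hd : 2 * d ≤ n) (g : ℝ → ℝ) {r : ℝ} (hr : 0 < r) :
    eigenIntegrand n d g (-r) + eigenIntegrand n d g r =
      2 ^ (n + 1) * (r ^ 2 * g r) * eigenWeight n d r := by
  have h := mul_eigenWeight hd r
  simp only [eigenIntegrand, abs_neg, abs_of_pos hr, sub_neg_eq_add, ← sub_eq_add_neg]
  linear_combination (-r * g r) * h

lemma eigenIntegrand_intervalIntegrable
    (hg : IntervalIntegrable (fun r => r ^ 2 * g r) volume 0 1) (d : ℕ) {ε : ℝ} (hε : 0 < ε)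
    (hε1 : ε ≤ 1) : IntervalIntegrable (fun r => eigenIntegrand n d g (-r)) volume ε 1 ∧
      IntervalIntegrable (eigenIntegrand n d g) volume ε 1 := by
  have hg' : IntervalIntegrable (fun r => r ^ 2 * g r) volume ε 1 :=
    hg.mono_set (by
      rw [Set.uIcc_of_le hε1, Set.uIcc_of_le zero_le_one]
      exact Set.Icc_subset_Icc_left hε.le)
  have hne : ∀ r ∈ Set.uIcc ε 1, r ^ 2 ≠ 0 := fun r hr => by
    rw [Set.uIcc_of_le hε1] at hr
    have := hε.trans_le hr.1
    positivity
  have hmem : ∀ r ∈ Set.uIoc ε 1, 0 < r := fun r hr => by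
    rw [Set.uIoc_of_le hε1] at hr
    exact hε.trans hr.1
  constructor
  · refine (hg'.continuousOn_mul
      (g := fun r => (-r) * (1 + -r) ^ (n - d + 1) * (1 - -r) ^ d / r ^ 2)
      (ContinuousOn.div (by fun_prop) (by fun_prop) hne)).congr fun r hr => ?_
    have := hmem r hr
    simp only [eigenIntegrand, abs_neg, abs_of_pos this]
    field_simp
  · refine (hg'.continuousOn_mul (g := fun r => r * (1 + r) ^ (n - d + 1) * (1 - r) ^ d / r ^ 2)
      (ContinuousOn.div (by fun_prop) (by fun_prop) hne)).congr fun r hr => ?_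
    have := hmem r hr
    simp only [eigenIntegrand, abs_of_pos this]
    field_simp

lemma eigenIntegrand_hasPrincipalValue
    (hg : IntervalIntegrable (fun r => r ^ 2 * g r) volume 0 1) {d : ℕ} (hd : 2 * d ≤ n) :
    HasPrincipalValue (eigenIntegrand n d g)
      (∫ r in (0 : ℝ)..1, 2 ^ (n + 1) * (r ^ 2 * g r) * eigenWeight n d r) := by
  set G : ℝ → ℝ := fun r => 2 ^ (n + 1) * (r ^ 2 * g r) * eigenWeight n d r with hG
  have hGint : IntervalIntegrable G volume 0 1 :=
    (hg.const_mul _).mul_continuousOn (continuous_eigenWeight n d).continuousOn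
  refine ⟨fun ε hε hε1 => ?_, ?_⟩
  · obtain ⟨h1, h2⟩ := eigenIntegrand_intervalIntegrable (n := n) hg d hε hε1
    refine ⟨?_, h2⟩
    rw [IntervalIntegrable.iff_comp_neg, neg_neg, neg_neg]
    exact h1.symm
  · have heq : ∀ ε ∈ Set.Ioc (0 : ℝ) 1, (∫ r in (0 : ℝ)..1, G r) - ∫ r in (0 : ℝ)..ε, G r =
        (∫ r in (-1 : ℝ)..(-ε), eigenIntegrand n d g r) +
          ∫ r in ε..1, eigenIntegrand n d g r := by
      intro ε hε
      obtain ⟨h1, h2⟩ := eigenIntegrand_intervalIntegrable (n := n) hg d hε.1 hε.2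
      rw [← intervalIntegral.integral_comp_neg, ← intervalIntegral.integral_add h1 h2,
        intervalIntegral.integral_interval_sub_left hGint (hGint.mono_set (by
          rw [Set.uIcc_of_le hε.1.le, Set.uIcc_of_le zero_le_one]
          exact Set.Icc_subset_Icc_right hε.2))]
      refine intervalIntegral.integral_congr fun r hr => ?_
      rw [Set.uIcc_of_le hε.2] at hr
      exact (eigenIntegrand_add_neg hd g (hε.1.trans_le hr.1)).symm
    have hcont : ContinuousWithinAt (fun ε => ∫ r in (0 : ℝ)..ε, G r) (Set.Icc 0 1) 0 := by
      have := intervalIntegral.continuousOn_primitive_interval' hGint (a := 0) (by simp)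
      rw [Set.uIcc_of_le zero_le_one] at this
      exact this 0 (by simp)
    have hlim : Tendsto (fun ε => ∫ r in (0 : ℝ)..ε, G r) (𝓝[>] 0) (𝓝 0) := by
      have h := hcont.tendsto
      rw [intervalIntegral.integral_same] at h
      refine h.mono_left ?_
      rw [← nhdsWithin_Ioc_eq_nhdsGT zero_lt_one]
      exact nhdsWithin_mono _ Set.Ioc_subset_Icc_self
    have h := (tendsto_const_nhds (x := ∫ r in (0 : ℝ)..1, G r)).sub hlim
    rw [sub_zero] at h
    refine h.congr' ?_
    filter_upwards [Ioc_mem_nhdsGT zero_lt_one] with ε hε using heq ε hε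

lemma integral_eigenIntegrand {d : ℕ} (hd : 2 * d ≤ n)
    (hF : IntervalIntegrable (eigenIntegrand n d g) volume (-1) 1) :
    ∫ r in (-1 : ℝ)..1, eigenIntegrand n d g r =
      ∫ r in (0 : ℝ)..1, 2 ^ (n + 1) * (r ^ 2 * g r) * eigenWeight n d r := by
  have h1 : IntervalIntegrable (eigenIntegrand n d g) volume (-1) 0 := hF.mono_set (by
    rw [Set.uIcc_of_le (by norm_num), Set.uIcc_of_le (by norm_num)]
    exact Set.Icc_subset_Icc_right zero_le_one)
  have h2 : IntervalIntegrable (eigenIntegrand n d g) volume 0 1 := hF.mono_set (by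
    rw [Set.uIcc_of_le (by norm_num), Set.uIcc_of_le (by norm_num)]
    exact Set.Icc_subset_Icc_left (by norm_num))
  have h1' : IntervalIntegrable (fun r => eigenIntegrand n d g (-r)) volume 0 1 := by
    rw [IntervalIntegrable.iff_comp_neg, neg_zero] at h1
    simpa using h1.symm
  rw [← intervalIntegral.integral_add_adjacent_intervals h1 h2,
    show (∫ r in (-1 : ℝ)..0, eigenIntegrand n d g r) =
      ∫ r in (0 : ℝ)..1, eigenIntegrand n d g (-r) by
        rw [intervalIntegral.integral_comp_neg, neg_zero],
    ← intervalIntegral.integral_add h1' h2]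
  refine intervalIntegral.integral_congr_ae (ae_of_all _ fun r hr => ?_)
  rw [Set.uIoc_of_le zero_le_one] at hr
  exact eigenIntegrand_add_neg hd g hr.1

end Ball

/-! ### Functional calculus and traces -/

lemma cfc_mulVec {ι : Type*} [Fintype ι] [DecidableEq ι] {A : Matrix ι ι ℂ}
    (hA : A.IsHermitian) (f : ℝ → ℝ) {v : ι → ℂ} {μ : ℝ} (hv : A.mulVec v = (μ : ℂ) • v) :
    (cfc f A).mulVec v = (f μ : ℂ) • v := by
  set U : Matrix ι ι ℂ := hA.eigenvectorUnitary.1 with hU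
  have hU1 : U * star U = 1 := Matrix.mem_unitaryGroup_iff.1 hA.eigenvectorUnitary.2
  have hU2 : star U * U = 1 := Matrix.mem_unitaryGroup_iff'.1 hA.eigenvectorUnitary.2
  have hspec : A = U * Matrix.diagonal (fun i => (hA.eigenvalues i : ℂ)) * star U := by
    conv_lhs => rw [hA.spectral_theorem, Unitary.conjStarAlgAut_apply]
    rfl
  have hcfc : cfc f A = U * Matrix.diagonal (fun i => (f (hA.eigenvalues i) : ℂ)) * star U := by
    rw [hA.cfc_eq, Matrix.IsHermitian.cfc, Unitary.conjStarAlgAut_apply]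
    rfl
  set u := (star U).mulVec v with hu
  have hvu : v = U.mulVec u := by rw [hu, Matrix.mulVec_mulVec, hU1, Matrix.one_mulVec]
  -- in the eigenbasis, a coordinate of `v` vanishes unless its eigenvalue is `μ`
  have hcoord : ∀ i, (hA.eigenvalues i : ℂ) * u i = μ * u i := by
    intro i
    have h := congrArg (star U).mulVec hv
    rw [hspec, Matrix.mulVec_smul, Matrix.mulVec_mulVec, Matrix.mul_assoc U, ← Matrix.mul_assoc,
      hU2, Matrix.one_mul, ← Matrix.mulVec_mulVec, ← hu] at h
    simpa [Matrix.mulVec_diagonal] using congrFun h i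
  have hd : (Matrix.diagonal (fun i => (f (hA.eigenvalues i) : ℂ))).mulVec u = (f μ : ℂ) • u := by
    ext i
    rw [Matrix.mulVec_diagonal, Pi.smul_apply, smul_eq_mul]
    rcases mul_eq_mul_right_iff.1 (hcoord i) with h | h
    · rw [Complex.ofReal_injective h]
    · rw [h, mul_zero, mul_zero]
  rw [hcfc, ← Matrix.mulVec_mulVec, ← hu, ← Matrix.mulVec_mulVec, hd, Matrix.mulVec_smul, ← hvu]

lemma Module.Basis.eigenspace_eq_span {ι V : Type*} [Fintype ι] [AddCommGroup V] [Module ℂ V]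
    (b : Module.Basis ι ℂ V) (L : Module.End ℂ V) {μ : ι → ℂ} (h : ∀ i, L (b i) = μ i • b i)
    (c : ℂ) : L.eigenspace c = Submodule.span ℂ (b '' {i | μ i = c}) := by
  apply le_antisymm
  · intro v hv
    rw [Module.End.mem_eigenspace_iff] at hv
    have hcoord : ∀ i, b.repr v i = 0 ∨ μ i = c := by
      intro i
      have h1 : b.repr (L v) i = μ i * b.repr v i := by
        have hcomp : (b.coord i).comp L = μ i • b.coord i := b.ext fun j => by
          by_cases hij : j = i
          · subst hij; simp [h]
          · simp [h, hij]
        exact LinearMap.congr_fun hcomp v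
      rw [hv, map_smul, Finsupp.smul_apply, smul_eq_mul] at h1
      rcases mul_eq_mul_right_iff.1 h1 with h2 | h2
      · exact Or.inr h2.symm
      · exact Or.inl h2
    rw [← b.sum_repr v]
    refine Submodule.sum_mem _ fun i _ => ?_
    rcases hcoord i with h0 | h0
    · rw [h0, zero_smul]; exact Submodule.zero_mem _
    · exact Submodule.smul_mem _ _ (Submodule.subset_span ⟨i, h0, rfl⟩)
  · rw [Submodule.span_le]
    rintro _ ⟨i, hi, rfl⟩
    exact Module.End.mem_eigenspace_iff.2 (by rw [h i, hi])

lemma Matrix.trace_eq_sum_of_basis {ι κ : Type*} [Fintype ι] [DecidableEq ι] [Fintype κ]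
    (b : Module.Basis κ ℂ (ι → ℂ)) (M : Matrix ι ι ℂ) {μ : κ → ℂ}
    (h : ∀ i, M.mulVec (b i) = μ i • b i) : M.trace = ∑ i, μ i := by
  classical
  rw [← Matrix.trace_toLin'_eq, LinearMap.trace_eq_matrix_trace ℂ b, Matrix.trace]
  refine Finset.sum_congr rfl fun i _ => ?_
  rw [Matrix.diag_apply, LinearMap.toMatrix_apply, Matrix.toLin'_apply, h i]
  simp

/-! ### Relative entropy -/

/-- Additivity of the entropy of the product distribution, by the mean of the binomial
distribution. -/
lemma sum_mul_log {a b : ℝ} (hab : a + b = 1) (n : ℕ) :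
    ∑ I : Finset (Fin n), a ^ I.card * b ^ (n - I.card) *
      Real.log (a ^ I.card * b ^ (n - I.card)) =
      n * (a * Real.log a + b * Real.log b) := by
  have hb : b = 1 - a := by linarith
  have hlog : ∀ I : Finset (Fin n), a ^ I.card * b ^ (n - I.card) *
      Real.log (a ^ I.card * b ^ (n - I.card)) =
      (fun k : ℕ => a ^ k * b ^ (n - k) * (k * Real.log a + (n - k) * Real.log b)) I.card := by
    intro I
    have hI : I.card ≤ n := by simpa using Finset.card_le_univ I
    by_cases h0 : a ^ I.card * b ^ (n - I.card) = 0
    · simp only [h0, zero_mul]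
    · rw [mul_eq_zero, not_or] at h0
      rw [Real.log_mul h0.1 h0.2, Real.log_pow, Real.log_pow, Nat.cast_sub hI]
  have hmean : ∑ k ∈ Finset.range (n + 1), (n.choose k : ℝ) * (k * (a ^ k * b ^ (n - k))) =
      n * a := by
    have h := congrArg (Polynomial.eval a) (bernsteinPolynomial.sum_smul ℝ n)
    simp only [bernsteinPolynomial, Polynomial.eval_finsetSum, nsmul_eq_mul, Polynomial.eval_mul,
      Polynomial.eval_natCast, Polynomial.eval_pow, Polynomial.eval_X, Polynomial.eval_sub,
      Polynomial.eval_one, ← hb] at h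
    rw [← h]
    exact Finset.sum_congr rfl fun k _ => by ring
  have hone : ∑ k ∈ Finset.range (n + 1), (n.choose k : ℝ) * (a ^ k * b ^ (n - k)) = 1 := by
    have h := add_pow a b n
    rw [hab, one_pow] at h
    rw [h]
    exact Finset.sum_congr rfl fun k _ => by ring
  rw [Finset.sum_congr rfl fun I _ => hlog I, ← Finset.powerset_univ]
  refine (Finset.sum_powerset_apply_card
    (fun k : ℕ => a ^ k * b ^ (n - k) * (k * Real.log a + (n - k) * Real.log b))).trans ?_
  rw [Finset.card_univ, Fintype.card_fin]
  have hexp : ∀ k ∈ Finset.range (n + 1),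
      n.choose k • (a ^ k * b ^ (n - k) * (k * Real.log a + (n - k) * Real.log b)) =
      (n.choose k : ℝ) * (k * (a ^ k * b ^ (n - k))) * (Real.log a - Real.log b) +
      (n.choose k : ℝ) * (a ^ k * b ^ (n - k)) * (n * Real.log b) := by
    intro k _
    rw [nsmul_eq_mul]
    ring
  rw [Finset.sum_congr rfl hexp, Finset.sum_add_distrib, ← Finset.sum_mul, ← Finset.sum_mul,
    hmean, hone, hb]
  ring

section AverageState

variable {n : ℕ} {w : EuclideanSpace ℝ (Fin 3) → ℝ} {g : ℝ → ℝ}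

lemma isHermitian_averageState (n : ℕ) (w : EuclideanSpace ℝ (Fin 3) → ℝ) :
    (averageState n w).IsHermitian := by
  ext I J
  rw [Matrix.conjTranspose_apply, averageState, Matrix.of_apply, Matrix.of_apply, Complex.star_def,
    ← integral_conj]
  congr 1
  ext p
  have h := congrFun (congrFun (tensorPower_conjTranspose n (qubit p)) I) J
  rw [qubit_conjTranspose, Matrix.conjTranspose_apply, Complex.star_def] at h
  rw [map_mul, ← h, Complex.conj_ofReal]

lemma averageState_mulVec_ballotVec
    (hint : IntegrableOn w (Metric.closedBall (0 : EuclideanSpace ℝ (Fin 3)) 1) volume)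
    (hrad : ∀ p ∈ Metric.closedBall (0 : EuclideanSpace ℝ (Fin 3)) 1, w p = g ‖p‖)
    {d : ℕ} (q : ↥(Finset.Icc d (n - d)) × BallotPath n d) :
    (averageState n w).mulVec (ballotVec n d q) = (ballEigenvalue n w d : ℂ) • ballotVec n d q :=
  q.2.isPairing.averageState_mulVec hint hrad q.1.2

/-- The vectors `v_{d,s}(P)` for all `d` form a basis: they are linearly independent, as the `λ_d`
are distinct, and there are `2^n` of them. -/
lemma exists_ballotBasis
    (hnn : ∀ p ∈ Metric.closedBall (0 : EuclideanSpace ℝ (Fin 3)) 1, 0 ≤ w p)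
    (hint : IntegrableOn w (Metric.closedBall (0 : EuclideanSpace ℝ (Fin 3)) 1) volume)
    (hone : ∫ p in Metric.closedBall (0 : EuclideanSpace ℝ (Fin 3)) 1, w p = 1)
    (hrad : ∀ p ∈ Metric.closedBall (0 : EuclideanSpace ℝ (Fin 3)) 1, w p = g ‖p‖) :
    ∃ b : Module.Basis (BallotIndex n) ℂ (Finset (Fin n) → ℂ),
      ∀ x, b x = ballotVec n x.1 x.2 := by
  have hli : LinearIndependent ℂ fun x : BallotIndex n => ballotVec n x.1 x.2 :=
    linearIndependent_sigma_of_eigenvalues (Matrix.toLin' (averageState n w))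
      (μ := fun d : Fin (n / 2 + 1) => (ballEigenvalue n w d : ℂ))
      (v := fun d : Fin (n / 2 + 1) => ballotVec n d)
      (fun d e h => Fin.ext (ballEigenvalue_injOn hnn hint hone
        (show 2 * (d : ℕ) ≤ n by omega) (show 2 * (e : ℕ) ≤ n by omega)
        (Complex.ofReal_injective h)))
      (fun d q => averageState_mulVec_ballotVec hint hrad q)
      (fun d => linearIndependent_ballotVec n d)
  have hne : Nonempty (BallotIndex n) := by
    rw [← Fintype.card_pos_iff, card_ballotIndex]
    positivity
  refine ⟨basisOfLinearIndependentOfCardEqFinrank hli ?_, fun x => ?_⟩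
  · rw [card_ballotIndex, Module.finrank_fintype_fun_eq_card, Fintype.card_finset,
      Fintype.card_fin]
  · rw [coe_basisOfLinearIndependentOfCardEqFinrank]

lemma eigenspace_averageState
    (hnn : ∀ p ∈ Metric.closedBall (0 : EuclideanSpace ℝ (Fin 3)) 1, 0 ≤ w p)
    (hint : IntegrableOn w (Metric.closedBall (0 : EuclideanSpace ℝ (Fin 3)) 1) volume)
    (hone : ∫ p in Metric.closedBall (0 : EuclideanSpace ℝ (Fin 3)) 1, w p = 1)
    (hrad : ∀ p ∈ Metric.closedBall (0 : EuclideanSpace ℝ (Fin 3)) 1, w p = g ‖p‖)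
    {d : ℕ} (hd : 2 * d ≤ n) :
    Module.End.eigenspace (Matrix.toLin' (averageState n w)) (ballEigenvalue n w d : ℂ) =
      Submodule.span ℂ (Set.range (ballotVec n d)) := by
  obtain ⟨b, hb⟩ := exists_ballotBasis (n := n) hnn hint hone hrad
  rw [b.eigenspace_eq_span _ (μ := fun x : BallotIndex n => (ballEigenvalue n w x.1 : ℂ))
    (fun x => by rw [hb]; exact averageState_mulVec_ballotVec hint hrad x.2)]
  congr 1
  ext v
  constructor
  · rintro ⟨⟨e, q⟩, he, rfl⟩
    have he : ((ballEigenvalue n w e : ℝ) : ℂ) = ballEigenvalue n w d := he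
    obtain rfl : (e : ℕ) = d := ballEigenvalue_injOn hnn hint hone
      (show 2 * (e : ℕ) ≤ n by omega) hd (Complex.ofReal_injective he)
    exact ⟨q, (hb ⟨e, q⟩).symm⟩
  · rintro ⟨q, rfl⟩
    exact ⟨⟨⟨d, by omega⟩, q⟩, rfl, hb ⟨⟨d, by omega⟩, q⟩⟩

lemma finrank_eigenspace_averageState
    (hnn : ∀ p ∈ Metric.closedBall (0 : EuclideanSpace ℝ (Fin 3)) 1, 0 ≤ w p)
    (hint : IntegrableOn w (Metric.closedBall (0 : EuclideanSpace ℝ (Fin 3)) 1) volume)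
    (hone : ∫ p in Metric.closedBall (0 : EuclideanSpace ℝ (Fin 3)) 1, w p = 1)
    (hrad : ∀ p ∈ Metric.closedBall (0 : EuclideanSpace ℝ (Fin 3)) 1, w p = g ‖p‖)
    {d : ℕ} (hd : 2 * d ≤ n) :
    (Module.finrank ℂ (Module.End.eigenspace (Matrix.toLin' (averageState n w))
      (ballEigenvalue n w d : ℂ)) : ℝ) =
      ((n : ℝ) - 2 * (d : ℝ) + 1) ^ 2 / ((n : ℝ) + 1) * ((n + 1).choose d : ℝ) := by
  rw [eigenspace_averageState hnn hint hone hrad hd,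
    finrank_span_eq_card (linearIndependent_ballotVec n d), card_ballotVec_index, Nat.cast_mul,
    card_ballotPath hd, show n - d + 1 - d = n - 2 * d + 1 by omega]
  push_cast [Nat.cast_sub hd]
  ring

lemma hasEigenvalue_averageState_iff
    (hnn : ∀ p ∈ Metric.closedBall (0 : EuclideanSpace ℝ (Fin 3)) 1, 0 ≤ w p)
    (hint : IntegrableOn w (Metric.closedBall (0 : EuclideanSpace ℝ (Fin 3)) 1) volume)
    (hone : ∫ p in Metric.closedBall (0 : EuclideanSpace ℝ (Fin 3)) 1, w p = 1)
    (hrad : ∀ p ∈ Metric.closedBall (0 : EuclideanSpace ℝ (Fin 3)) 1, w p = g ‖p‖) (μ : ℂ) :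
    Module.End.HasEigenvalue (Matrix.toLin' (averageState n w)) μ ↔
      ∃ d : ℕ, 2 * d ≤ n ∧ μ = (ballEigenvalue n w d : ℂ) := by
  constructor
  · intro h
    obtain ⟨b, hb⟩ := exists_ballotBasis (n := n) hnn hint hone hrad
    rw [Module.End.hasEigenvalue_iff, b.eigenspace_eq_span _
      (μ := fun x : BallotIndex n => (ballEigenvalue n w x.1 : ℂ))
      (fun x => by rw [hb]; exact averageState_mulVec_ballotVec hint hrad x.2)] at h
    by_contra! hne
    refine h ?_
    rw [Submodule.span_eq_bot]
    rintro _ ⟨x, hx, rfl⟩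
    exact absurd hx.symm (hne x.1 (by omega))
  · rintro ⟨d, hd, rfl⟩
    rw [Module.End.hasEigenvalue_iff]
    intro h0
    have h := finrank_eigenspace_averageState hnn hint hone hrad hd
    rw [h0, finrank_bot] at h
    have h1 := cast_sub_two_mul_add_one_pos hd
    have h2 : (0 : ℝ) < (n + 1).choose d := by
      exact_mod_cast Nat.choose_pos (by omega)
    have : 0 < ((n : ℝ) - 2 * (d : ℝ) + 1) ^ 2 / ((n : ℝ) + 1) * ((n + 1).choose d : ℝ) := by
      positivity
    rw [← h] at this
    simp at this

lemma posDef_averageState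
    (hnn : ∀ p ∈ Metric.closedBall (0 : EuclideanSpace ℝ (Fin 3)) 1, 0 ≤ w p)
    (hint : IntegrableOn w (Metric.closedBall (0 : EuclideanSpace ℝ (Fin 3)) 1) volume)
    (hone : ∫ p in Metric.closedBall (0 : EuclideanSpace ℝ (Fin 3)) 1, w p = 1)
    (hrad : ∀ p ∈ Metric.closedBall (0 : EuclideanSpace ℝ (Fin 3)) 1, w p = g ‖p‖) :
    (averageState n w).PosDef := by
  have hH := isHermitian_averageState n w
  rw [hH.posDef_iff_eigenvalues_pos]
  intro i
  have hev : Module.End.HasEigenvalue (Matrix.toLin' (averageState n w))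
      (hH.eigenvalues i : ℂ) := by
    refine Module.End.hasEigenvalue_of_hasEigenvector (x := ⇑(hH.eigenvectorBasis i))
      ⟨Module.End.mem_eigenspace_iff.2 ?_, fun h0 => ?_⟩
    · rw [Matrix.toLin'_apply, hH.mulVec_eigenvectorBasis i]
      rfl
    · exact hH.eigenvectorBasis.orthonormal.ne_zero i (by ext j; exact congrFun h0 j)
  obtain ⟨d, hd, hμ⟩ := (hasEigenvalue_averageState_iff hnn hint hone hrad _).1 hev
  rw [Complex.ofReal_injective hμ]
  exact ballEigenvalue_pos hnn hint hone hd

/-- By unitary invariance, the entropy only depends on the spectrum of `ρ`, so that `ρ^{⊗n}` may be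
taken diagonal, and then diagonal in the basis of the `v_{d,s}(P)`. -/
lemma quantumRelativeEntropy_eq
    (hnn : ∀ p ∈ Metric.closedBall (0 : EuclideanSpace ℝ (Fin 3)) 1, 0 ≤ w p)
    (hint : IntegrableOn w (Metric.closedBall (0 : EuclideanSpace ℝ (Fin 3)) 1) volume)
    (hone : ∫ p in Metric.closedBall (0 : EuclideanSpace ℝ (Fin 3)) 1, w p = 1)
    (hrad : ∀ p ∈ Metric.closedBall (0 : EuclideanSpace ℝ (Fin 3)) 1, w p = g ‖p‖)
    (p : EuclideanSpace ℝ (Fin 3)) :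
    quantumRelativeEntropy (tensorPower n (qubit p)) (averageState n w) =
      ((n * ((1 + ‖p‖) / 2 * Real.log ((1 + ‖p‖) / 2) + (1 - ‖p‖) / 2 * Real.log ((1 - ‖p‖) / 2)) -
        ∑ d ∈ Finset.range (n / 2 + 1), ((n : ℝ) - 2 * (d : ℝ) + 1) / ((n : ℝ) + 1) *
          ((n + 1).choose d : ℝ) * eigenWeight n d ‖p‖ * Real.log (ballEigenvalue n w d) : ℝ) :
          ℂ) := by
  obtain ⟨U, t, hU, hU', ht, hp⟩ := exists_unitary_qubit p
  set a := (1 + t) / 2 with ha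
  set b := (1 - t) / 2 with hb
  set W := tensorPower n U with hW
  set V := tensorPower n U.conjTranspose with hV
  set δ : Finset (Fin n) → ℝ := fun I => a ^ I.card * b ^ (n - I.card) with hδ
  set D : Matrix (Finset (Fin n)) (Finset (Fin n)) ℂ := Matrix.diagonal fun I => (δ I : ℂ) with hD
  have hWV : W * V = 1 := by rw [hW, hV, ← tensorPower_mul, hU, tensorPower_one]
  have hVW : V * W = 1 := by rw [hW, hV, ← tensorPower_mul, hU', tensorPower_one]
  have hρ : tensorPower n (qubit p) = W * D * V := by
    rw [hp, tensorPower_mul, tensorPower_mul, tensorPower_diagonal]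
    congr 3
    ext I
    simp [hδ]
  have hρH : (tensorPower n (qubit p)).IsHermitian := by
    rw [Matrix.IsHermitian, ← tensorPower_conjTranspose, qubit_conjTranspose]
  -- the logarithm of `ρ^{⊗n}` is diagonalized by the same unitary matrix
  have hlogρ : cfc Real.log (tensorPower n (qubit p)) =
      W * (Matrix.diagonal fun I => (Real.log (δ I) : ℂ)) * V := by
    have h : cfc Real.log (tensorPower n (qubit p)) * W =
        W * Matrix.diagonal fun I => (Real.log (δ I) : ℂ) := by
      ext I J
      have hv : (tensorPower n (qubit p)).mulVec (fun I => W I J) =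
          (δ J : ℂ) • fun I => W I J := by
        have h1 : tensorPower n (qubit p) * W = W * D := by
          rw [hρ, Matrix.mul_assoc, hVW, Matrix.mul_one]
        ext K
        have h2 := congrFun (congrFun h1 K) J
        rw [hD, Matrix.mul_diagonal, mul_comm] at h2
        exact h2
      have h3 := congrFun (cfc_mulVec hρH Real.log hv) I
      rw [Matrix.mul_diagonal, mul_comm]
      exact h3
    rw [← h, Matrix.mul_assoc, hWV, Matrix.mul_one]
  have htr1 : (tensorPower n (qubit p) * cfc Real.log (tensorPower n (qubit p))).trace =
      ((n * (a * Real.log a + b * Real.log b) : ℝ) : ℂ) := by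
    have h : tensorPower n (qubit p) * cfc Real.log (tensorPower n (qubit p)) =
        W * (D * (Matrix.diagonal fun I => (Real.log (δ I) : ℂ)) * V) := by
      rw [hlogρ, hρ]
      simp only [Matrix.mul_assoc]
      rw [← Matrix.mul_assoc V W, hVW, Matrix.one_mul]
    rw [h, Matrix.trace_mul_comm, Matrix.mul_assoc, hVW, Matrix.mul_one, hD,
      Matrix.diagonal_mul_diagonal, Matrix.trace_diagonal,
      ← sum_mul_log (show a + b = 1 by rw [ha, hb]; ring) n]
    push_cast [hδ]
    rfl
  have htr2 : (tensorPower n (qubit p) * cfc Real.log (averageState n w)).trace =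
      ((∑ d ∈ Finset.range (n / 2 + 1), ((n : ℝ) - 2 * (d : ℝ) + 1) / ((n : ℝ) + 1) *
          ((n + 1).choose d : ℝ) * eigenWeight n d t * Real.log (ballEigenvalue n w d) : ℝ) :
          ℂ) := by
    have hcomm : Commute (cfc Real.log (averageState n w)) W :=
      (averageState_commute hint hrad hU hU').cfc_real Real.log
    have h : (tensorPower n (qubit p) * cfc Real.log (averageState n w)).trace =
        (D * cfc Real.log (averageState n w)).trace := by
      rw [hρ, Matrix.mul_assoc, Matrix.mul_assoc, Matrix.trace_mul_comm, Matrix.mul_assoc,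
        Matrix.mul_assoc, hcomm.eq, ← Matrix.mul_assoc V, hVW, Matrix.one_mul]
    obtain ⟨B, hB⟩ := exists_ballotBasis (n := n) hnn hint hone hrad
    have hdiag : ∀ x : BallotIndex n, (D * cfc Real.log (averageState n w)).mulVec (B x) =
        ((Real.log (ballEigenvalue n w x.1) * (a ^ (x.2.1 : ℕ) * b ^ (n - (x.2.1 : ℕ))) : ℝ) : ℂ) •
          B x := by
      intro x
      rw [hB, ← Matrix.mulVec_mulVec, cfc_mulVec (isHermitian_averageState n w) Real.log
        (averageState_mulVec_ballotVec hint hrad x.2), Matrix.mulVec_smul, Complex.ofReal_mul,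
        ← smul_smul]
      congr 1
      ext T
      rw [hD, Matrix.mulVec_diagonal, Pi.smul_apply, smul_eq_mul]
      by_cases hT : T.card = x.2.1
      · simp only [hδ, hT]
      · have : ballotVec n x.1 x.2 T = 0 :=
          x.2.2.isPairing.vVec_eq_zero (Finset.mem_Icc.1 x.2.1.2).1 hT
        rw [this, mul_zero, mul_zero]
    rw [h, Matrix.trace_eq_sum_of_basis B _ hdiag, ← Complex.ofReal_sum, Complex.ofReal_inj,
      Fintype.sum_sigma, Finset.sum_range]
    refine Finset.sum_congr rfl fun d _ => ?_
    rw [Fintype.sum_prod_type]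
    simp only [Finset.sum_const, Finset.card_univ, nsmul_eq_mul]
    rw [← card_ballotPath (show 2 * (d : ℕ) ≤ n by omega), eigenWeight, ← Finset.mul_sum,
      ← Finset.mul_sum, Finset.sum_coe_sort (Finset.Icc (d : ℕ) (n - d))
        (fun s => a ^ s * b ^ (n - s))]
    ring
  have hweight : ∀ d ∈ Finset.range (n / 2 + 1), eigenWeight n d t = eigenWeight n d ‖p‖ := by
    intro d hd
    rw [Finset.mem_range] at hd
    rcases ht with rfl | rfl
    · rfl
    · exact eigenWeight_neg (by omega) _
  rw [quantumRelativeEntropy, Matrix.mul_sub, Matrix.trace_sub, htr1, htr2, ← Complex.ofReal_sub,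
    Finset.sum_congr rfl fun d hd => by rw [hweight d hd]]
  congr 2
  rcases ht with h | h
  · rw [ha, hb, h]
  · rw [ha, hb, h, sub_neg_eq_add, ← sub_eq_add_neg]
    ring

end AverageState

theorem theorem15 (n : ℕ) (w : EuclideanSpace ℝ (Fin 3) → ℝ) (g : ℝ → ℝ)
    -- `w` is a probability density on the unit ball
    (hw_nonneg : ∀ p ∈ Metric.closedBall (0 : EuclideanSpace ℝ (Fin 3)) 1, 0 ≤ w p)
    (hw_int : IntegrableOn w (Metric.closedBall (0 : EuclideanSpace ℝ (Fin 3)) 1) volume)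
    (hw_one : ∫ p in Metric.closedBall (0 : EuclideanSpace ℝ (Fin 3)) 1, w p = 1)
    -- and it depends on the radius only
    (hw_radial : ∀ p ∈ Metric.closedBall (0 : EuclideanSpace ℝ (Fin 3)) 1, w p = g ‖p‖) :
    ∃ lam : ℕ → ℝ,
      -- the formula for `lam d`, as a principal value at `r = 0`
      (∀ d : ℕ, 2 * d ≤ n → ∃ a : ℝ,
        HasPrincipalValue (eigenIntegrand n d g) a ∧ lam d = eigenFactor n d * a) ∧
      -- and with the ordinary integral, whenever it converges absolutely
      (∀ d : ℕ, 2 * d ≤ n → IntervalIntegrable (eigenIntegrand n d g) volume (-1) 1 →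
        lam d = eigenFactor n d * ∫ r in (-1 : ℝ)..1, eigenIntegrand n d g r) ∧
      -- the averaged state is Hermitian and positive definite
      (averageState n w).PosDef ∧
      -- its eigenvalues are exactly the `lam d`
      (∀ μ : ℂ, Module.End.HasEigenvalue (Matrix.toLin' (averageState n w)) μ ↔
        ∃ d : ℕ, 2 * d ≤ n ∧ μ = (lam d : ℂ)) ∧
      -- the `v_{d,s}(P)` are a basis of the eigenspace of `lam d`, of the stated dimension
      (∀ d : ℕ, 2 * d ≤ n →
        LinearIndependent ℂ (ballotVec n d) ∧
        Module.End.eigenspace (Matrix.toLin' (averageState n w)) (lam d : ℂ) =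
          Submodule.span ℂ (Set.range (ballotVec n d)) ∧
        (Module.finrank ℂ
            (Module.End.eigenspace (Matrix.toLin' (averageState n w)) (lam d : ℂ)) : ℝ) =
          ((n : ℝ) - 2 * (d : ℝ) + 1) ^ 2 / ((n : ℝ) + 1) * ((n + 1).choose d : ℝ)) ∧
      -- the relative entropy, for `0 < r ≤ 1`
      (∀ p : EuclideanSpace ℝ (Fin 3), ∀ r : ℝ, r = ‖p‖ → 0 < r → r ≤ 1 →
        quantumRelativeEntropy (tensorPower n (qubit p)) (averageState n w) =
          (((n : ℝ) / 2 * (1 - r) * Real.log ((1 - r) / 2)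
            + (n : ℝ) / 2 * (1 + r) * Real.log ((1 + r) / 2)
            - ∑ d ∈ Finset.range (n / 2 + 1),
                ((n : ℝ) - 2 * (d : ℝ) + 1) / ((n : ℝ) + 1) * ((n + 1).choose d : ℝ)
                  * (1 / (2 ^ (n + 1) * r))
                  * ((1 + r) ^ (n - d + 1) * (1 - r) ^ d - (1 + r) ^ d * (1 - r) ^ (n - d + 1))
                  * Real.log (lam d) : ℝ) : ℂ)) ∧
      -- the relative entropy for `r = 0`, where the formula is read as its limit for `r ↓ 0`
      quantumRelativeEntropy (tensorPower n (qubit 0)) (averageState n w) =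
        ((-(n : ℝ) * Real.log 2
          - ∑ d ∈ Finset.range (n / 2 + 1),
              ((n : ℝ) - 2 * (d : ℝ) + 1) ^ 2 / ((n : ℝ) + 1) * ((n + 1).choose d : ℝ)
                * (1 / 2 ^ n) * Real.log (lam d) : ℝ) : ℂ) := by
  refine ⟨ballEigenvalue n w, ?_, ?_, posDef_averageState hw_nonneg hw_int hw_one hw_radial,
    hasEigenvalue_averageState_iff hw_nonneg hw_int hw_one hw_radial, ?_, ?_, ?_⟩
  · exact fun d hd => ⟨_, eigenIntegrand_hasPrincipalValue
      (intervalIntegrable_radial hw_int hw_radial) hd, ballEigenvalue_eq_radial hw_radial⟩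
  · intro d hd hF
    rw [integral_eigenIntegrand hd hF]
    exact ballEigenvalue_eq_radial hw_radial
  · exact fun d hd => ⟨linearIndependent_ballotVec n d,
      eigenspace_averageState hw_nonneg hw_int hw_one hw_radial hd,
      finrank_eigenspace_averageState hw_nonneg hw_int hw_one hw_radial hd⟩
  · rintro p r rfl hr -
    rw [quantumRelativeEntropy_eq hw_nonneg hw_int hw_one hw_radial, Complex.ofReal_inj]
    congr 1
    · ring
    · refine Finset.sum_congr rfl fun d hd => ?_
      rw [Finset.mem_range] at hd
      rw [← mul_eigenWeight (show 2 * d ≤ n by omega)]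
      field_simp
  · rw [quantumRelativeEntropy_eq hw_nonneg hw_int hw_one hw_radial, norm_zero,
      Complex.ofReal_inj]
    congr 1
    · rw [add_zero, sub_zero, one_div, Real.log_inv]
      ring
    · refine Finset.sum_congr rfl fun d hd => ?_
      rw [Finset.mem_range] at hd
      rw [eigenWeight_zero (show 2 * d ≤ n by omega)]
      ring
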